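/- **Theorem 4.3 (second-order chain rule for fully amenable compositions with piecewise linear outer functions).** For an extended-real-valued function $f$ on a Euclidean space, let $\partial f$ and $\partial^\infty f$ be its basic (limiting) and singular subdifferentials (empty where $f$ is not finite), let $N(\cdot;\Omega)$ be the basic (limiting) normal cone to a set $\Omega$, and for $y\in\partial f(x)$ let $$\partial^2 f(x,y)(u)=\{w\mid (w,-u)\in N((x,y);\operatorname{gph}\partial f)\}$$ be the second-order subdifferential of $f$ at $x$ relative to $y$. Let $\varphi\colon\mathbb R^n\to\overline{\mathbb R}$ be proper and finite at $\bar x$, and let $\varphi=\theta\circ h$ on a neighborhood of $\bar x$, where $h\colon\mathbb R^n\to\mathbb R^m$ is of class $C^2$ around $\bar x$ and $\theta\colon\mathbb R^m\to\overline{\mathbb R}$ is proper, lower semicontinuous, convex and piecewise linear (its domain is a finite union of polyhedral sets on each of which $\theta$ is affine). With $\bar z:=h(\bar x)$, assume that $\partial^\infty\theta(\bar z)\cap\ker\nabla h(\bar x)^*=\{0\}$, so that $\varphi=\theta\circ h$ is a fully amenable composition at $\bar x$. Let $\bar y\in\partial\varphi(\bar x)$, and let $S(z)$ be the linear subspace parallel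 to the affine hull of $\partial\theta(z)$ (with $S(z)=\{0\}$ if $\partial\theta(z)=\emptyset$). Consider the basic second-order qualification condition $$\text{(SOQC)}\qquad \partial^2\theta(\bar z,v)(0)\cap\ker\nabla h(\bar x)^*=\{0\}\quad\text{whenever } v\in\partial\theta(\bar z),\ \nabla h(\bar x)^*v=\bar y.$$ Then: 1. If (SOQC) holds, there is a unique $\bar v\in\partial\theta(\bar z)$ with $\nabla h(\bar x)^*\bar v=\bar y$, and $$\partial^2\varphi(\bar x,\bar y)(u)=\nabla^2\langle\bar v,h\rangle(\bar x)u+\nabla h(\bar x)^*\,\partial^2\theta(\bar z,\bar v)\big(\nabla h(\bar x)u\big)\quad\text{for all } u\in\mathbb R^n.$$ 2. $\partial^2\theta(\bar z,v)(0)=S(\bar z)$ for every $v\in\partial\theta(\bar z)$. 3. (SOQC) holds if and only if $S(z)\cap\ker\nabla h(\bar x)^*=\{0\}$ for all $z$ in some neighborhood of $\bar z$. 4. (SOQC) holds if and only if, with $P$ the orthogonal projection of $\mathbb R^m$ onto $S(\bar z)$, the linear map $P\,\nabla h(x)$ has full rank $\dim S(\bar z)$ for all $x$ in some neighborhood of $\bar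 x$. -/

import Mathlib

open Filter Topology

noncomputable section

namespace VarAnalysis

section FirstOrder

variable {E : Type*} [NormedAddCommGroup E] [InnerProductSpace ℝ E]

/-- The regular (Fréchet) subdifferential of an extended-real-valued function. It is empty at points
where the function is not finite; at points of finiteness, membership of `v` is the `ε`-form of
`liminf_{x' → x, x' ≠ x} (f x' - f x - ⟪v, x' - x⟫) / ‖x' - x‖ ≥ 0`. -/
def regularSubdiff (f : E → EReal) (x : E) : Set E :=
  {v | f x ≠ ⊤ ∧ f x ≠ ⊥ ∧ ∀ ε : ℝ, 0 < ε → ∀ᶠ x' in 𝓝 x,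
    (((f x).toReal + inner ℝ v (x' - x) - ε * ‖x' - x‖ : ℝ) : EReal) ≤ f x'}

/-- The basic (limiting, Mordukhovich) subdifferential; empty at points where `f` is not finite. -/
def basicSubdiff (f : E → EReal) (x : E) : Set E :=
  {v | f x ≠ ⊤ ∧ f x ≠ ⊥ ∧ ∃ (xs vs : ℕ → E),
    Tendsto xs atTop (𝓝 x) ∧ Tendsto (fun k => f (xs k)) atTop (𝓝 (f x)) ∧
    (∀ k, vs k ∈ regularSubdiff f (xs k)) ∧ Tendsto vs atTop (𝓝 v)}

/-- The singular (horizontal) subdifferential: limits of `t k • vs k` with `t k ↓ 0` and `vs k`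
regular subgradients at `xs k → x`, `f (xs k) → f x`; empty at points where `f` is not finite. -/
def singularSubdiff (f : E → EReal) (x : E) : Set E :=
  {v | f x ≠ ⊤ ∧ f x ≠ ⊥ ∧ ∃ (xs vs : ℕ → E) (t : ℕ → ℝ),
    Tendsto xs atTop (𝓝 x) ∧ Tendsto (fun k => f (xs k)) atTop (𝓝 (f x)) ∧
    (∀ k, 0 < t k) ∧ Tendsto t atTop (𝓝 0) ∧
    (∀ k, vs k ∈ regularSubdiff f (xs k)) ∧ Tendsto (fun k => t k • vs k) atTop (𝓝 v)}

/-- The regular normal cone: `limsup_{x' → x, x' ∈ Ω} ⟪v, x' - x⟫ / ‖x' - x‖ ≤ 0`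
(empty for `x ∉ Ω`). -/
def regularNormalCone (Ω : Set E) (x : E) : Set E :=
  {v | x ∈ Ω ∧ ∀ ε : ℝ, 0 < ε → ∀ᶠ x' in 𝓝[Ω] x, inner ℝ v (x' - x) ≤ ε * ‖x' - x‖}

/-- The basic (limiting, Mordukhovich) normal cone (empty for `x ∉ Ω`). -/
def normalCone (Ω : Set E) (x : E) : Set E :=
  {v | x ∈ Ω ∧ ∃ (xs vs : ℕ → E), Tendsto xs atTop (𝓝 x) ∧
    (∀ k, vs k ∈ regularNormalCone Ω (xs k)) ∧ Tendsto vs atTop (𝓝 v)}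

/-- `f` is proper: it never takes the value `-∞` and is finite somewhere. -/
def ProperFun (f : E → EReal) : Prop :=
  (∀ x, f x ≠ ⊥) ∧ ∃ x, f x ≠ ⊤

/-- Convexity of an extended-real-valued function through its epigraph. -/
def ConvexFun (f : E → EReal) : Prop :=
  Convex ℝ {p : E × ℝ | f p.1 ≤ (p.2 : EReal)}

/-- A polyhedral set: a finite intersection of closed half-spaces. -/
def PolyhedralSet (P : Set E) : Prop :=
  ∃ (k : ℕ) (a : Fin k → E) (b : Fin k → ℝ), P = {x | ∀ i, inner ℝ (a i) x ≤ b i}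

/-- `f` is piecewise linear-quadratic: its domain is a finite union of polyhedral sets, relative to
each of which `f x = ½ ⟪x, A x⟫ + ⟪a, x⟫ + α` with `A` symmetric. -/
def PiecewiseLinearQuadratic (f : E → EReal) : Prop :=
  ∃ (k : ℕ) (P : Fin k → Set E) (A : Fin k → E →ₗ[ℝ] E) (a : Fin k → E) (α : Fin k → ℝ),
    (∀ i, PolyhedralSet (P i)) ∧ (∀ i, (A i).IsSymmetric) ∧ {x | f x < ⊤} = ⋃ i, P i ∧
    ∀ i, ∀ x ∈ P i,
      f x = (((1 / 2 : ℝ) * inner ℝ x (A i x) + inner ℝ (a i) x + α i : ℝ) : EReal)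

/-- `f` is piecewise linear: its domain is a finite union of polyhedral sets, relative to each of
which `f x = ⟪a, x⟫ + α`. -/
def PiecewiseLinear (f : E → EReal) : Prop :=
  ∃ (k : ℕ) (P : Fin k → Set E) (a : Fin k → E) (α : Fin k → ℝ),
    (∀ i, PolyhedralSet (P i)) ∧ {x | f x < ⊤} = ⋃ i, P i ∧
    ∀ i, ∀ x ∈ P i, f x = ((inner ℝ (a i) x + α i : ℝ) : EReal)

/-- The linear subspace parallel to the affine hull of `∂f(z)`. -/
def parallelSubspace (f : E → EReal) (z : E) : Submodule ℝ E :=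
  (affineSpan ℝ (basicSubdiff f z)).direction

end FirstOrder

section SecondOrder

variable {E G : Type*} [NormedAddCommGroup E] [InnerProductSpace ℝ E]
  [NormedAddCommGroup G] [InnerProductSpace ℝ G]

/-- The graph of a set-valued mapping, inside the product with its Euclidean (`ℓ²`) structure. -/
def gph (F : E → Set G) : Set (WithLp 2 (E × G)) :=
  {p | p.snd ∈ F p.fst}

/-- The (Mordukhovich) coderivative `D*F(x, y)(v) = {u | (u, -v) ∈ N((x, y); gph F)}`. -/
def coderivative (F : E → Set G) (x : E) (y : G) (v : G) : Set E :=
  {u | WithLp.toLp 2 (u, -v) ∈ normalCone (gph F) (WithLp.toLp 2 (x, y))}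

/-- The second-order subdifferential `∂²f(x, y)(u) = (D*∂f)(x, y)(u)`. -/
def secondOrderSubdiff (f : E → EReal) (x y u : E) : Set E :=
  coderivative (basicSubdiff f) x y u

end SecondOrder

section Composition

variable {E G : Type*} [NormedAddCommGroup E] [InnerProductSpace ℝ E] [CompleteSpace E]
  [NormedAddCommGroup G] [InnerProductSpace ℝ G] [CompleteSpace G]

/-- The adjoint `∇h(x)*` of the derivative of `h` at `x`. -/
def jacAdjoint (h : E → G) (x : E) : G →L[ℝ] E :=
  ContinuousLinearMap.adjoint (fderiv ℝ h x)

/-- The Hessian `∇²⟨v, h⟩(x)` of the scalarization `x' ↦ ⟪v, h x'⟫`. -/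
def scalarizedHessian (h : E → G) (v : G) (x : E) : E →L[ℝ] E :=
  fderiv ℝ (gradient (fun x' => inner ℝ v (h x'))) x

/-- `φ` is strongly amenable at `x` with the composite representation `φ = θ ∘ h` near `x`. -/
structure StronglyAmenableComp (φ : E → EReal) (θ : G → EReal) (h : E → G) (x : E) : Prop where
  proper : ProperFun φ
  eventuallyEq : ∀ᶠ x' in 𝓝 x, φ x' = θ (h x')
  finite_at : φ x ≠ ⊤
  smooth : ContDiffAt ℝ 2 h x
  outer_proper : ProperFun θ
  outer_lsc : LowerSemicontinuous θ
  outer_convex : ConvexFun θ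
  /-- The first-order qualification condition `∂^∞θ(h(x)) ∩ ker ∇h(x)* = {0}`. -/
  firstOrderQC : singularSubdiff θ (h x) ∩ {v | jacAdjoint h x v = 0} = {0}

/-- `φ` is fully amenable at `x` with the composite representation `φ = θ ∘ h` near `x`. -/
structure FullyAmenableComp (φ : E → EReal) (θ : G → EReal) (h : E → G) (x : E) : Prop
    extends StronglyAmenableComp φ θ h x where
  outer_plq : PiecewiseLinearQuadratic θ

/-- The basic second-order qualification condition at `x` relative to `y`:
`∂²θ(z, v)(0) ∩ ker ∇h(x)* = {0}` whenever `v ∈ ∂θ(z)` and `∇h(x)* v = y`, where `z = h(x)`. -/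
def SecondOrderQC (θ : G → EReal) (h : E → G) (x y : E) : Prop :=
  ∀ v ∈ basicSubdiff θ (h x), jacAdjoint h x v = y →
    secondOrderSubdiff θ (h x) v 0 ∩ {w | jacAdjoint h x w = 0} = {0}

end Composition

end VarAnalysis

end

open VarAnalysis

/-!
# Second-order chain rule for piecewise linear outer functions

Fix `z̄ = h x̄`. A convex piecewise linear `θ` is affine on short rays from `z̄` (`RadiallyAffine`),
which makes the graph of `∂θ` near `z̄` rigid in two ways. Subgradients at nearby points are
subgradients at `z̄` (`RadiallyAffine.convexSubdiff_subset`), so they all lie in a translate of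
`S = S(z̄)`. Moreover the epigraph of `θ` coincides near `(z̄, θ z̄)` with a closed convex cone, and
separating points from that cone shows that `θ` is affine along `Sᗮ`, so that `∂θ` is invariant
under small displacements in `Sᗮ` (`RadiallyAffine.convexSubdiff_subset_of_sub_mem`).

These two facts give `∂²θ(z̄, v)(0) = S` (`coderivative_convexSubdiff_zero`): invariance along `Sᗮ`
puts the first component of a regular normal in `S`, and conversely at a pair `(z̄, v')` with `v'` in
the relative interior of `∂θ(z̄)` the graph is so thin that all of `S × {0}` is normal to it.
Together with the existence of a multiplier, this identifies (SOQC) with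
`S ∩ ker ∇h(x̄)* = {0}`, a condition that is stable under perturbations and dual to surjectivity of
the projected derivative.

The existence of a multiplier, `∂(θ ∘ h)(x̄) ⊆ ∇h(x̄)* ∂θ(z̄)`, only needs the first-order
qualification condition. It is proved by penalizing the constraint `z = h x`
(`exists_approx_of_mem_regularSubdiff`, `basicSubdiff_subset_jacAdjoint_image`).

For the second-order rule, `S ∩ ker ∇h(x̄)* = {0}` makes `∇h(x)*` uniformly injective on `S` and the
projection of `h` onto `S` metrically regular near `x̄`. Hence `(x, v) ↦ (x, ∇h(x)* v)` parametrizes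
the graph of `∂φ` by the pairs with `v ∈ ∂θ(h x)`, and the regular normals to that graph can be
computed exactly at every point near `x̄`: they are
`(∇²⟨v, h⟩(x) u + ∇h(x)* q, -u)` with `(q, -∇h(x) u)` a regular normal to the graph of `∂θ`
(`regularNormal_comp_of_regularNormal`, `exists_regularNormal_of_regularNormal_comp`). The formula
passes to the limit because the multipliers `q` can be taken in `S`, where `∇h(x)*` controls them
(`coderivative_comp`).
-/

namespace VarAnalysis

/-! ### Convex subgradients -/

section Convex

variable {E : Type*} [NormedAddCommGroup E] [InnerProductSpace ℝ E]

/-- The subdifferential of convex analysis, written through the epigraph so that the subgradient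
inequality only involves real numbers. -/
def convexSubdiff (f : E → EReal) (x : E) : Set E :=
  {v | ∃ r : ℝ, f x = r ∧ ∀ (x' : E) (s : ℝ), f x' ≤ s → r + inner ℝ v (x' - x) ≤ s}

lemma coe_le_of_forall_real {a : ℝ} {y : EReal} (h : ∀ s : ℝ, y ≤ s → a ≤ s) :
    (a : EReal) ≤ y := by
  induction y with
  | bot => exact absurd (h (a - 1) bot_le) (by linarith)
  | coe y => exact_mod_cast h y le_rfl
  | top => exact le_top

lemma convexSubdiff_subset_regularSubdiff (f : E → EReal) (x : E) :
    convexSubdiff f x ⊆ regularSubdiff f x := by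
  rintro v ⟨r, hr, h⟩
  refine ⟨by simp [hr], by simp [hr], fun ε hε => Eventually.of_forall fun x' => ?_⟩
  refine coe_le_of_forall_real fun s hs => ?_
  have := h x' s hs
  have h2 : 0 ≤ ε * ‖x' - x‖ := by positivity
  simp only [hr, EReal.toReal_coe]
  linarith

lemma regularSubdiff_subset_basicSubdiff (f : E → EReal) (x : E) :
    regularSubdiff f x ⊆ basicSubdiff f x := fun v hv =>
  ⟨hv.1, hv.2.1, fun _ => x, fun _ => v, tendsto_const_nhds, tendsto_const_nhds, fun _ => hv,
    tendsto_const_nhds⟩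

/-- Epigraphical form of the convexity inequality along a segment. -/
lemma ConvexFun.segment_le {f : E → EReal} (hf : ConvexFun f) {x y : E} {r s t : ℝ}
    (hx : f x ≤ r) (hy : f y ≤ s) (h0 : 0 ≤ t) (h1 : t ≤ 1) :
    f (x + t • (y - x)) ≤ ((r + t * (s - r) : ℝ) : EReal) := by
  have := hf (x := (x, r)) hx (y := (y, s)) hy (a := 1 - t) (b := t) (by linarith) h0 (by ring)
  simp only [Prod.smul_mk, Prod.mk_add_mk, Set.mem_ofPred_eq, smul_eq_mul] at this
  convert this using 2
  · module
  · ring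

lemma ConvexFun.regularSubdiff_subset {f : E → EReal} (hf : ConvexFun f) (x : E) :
    regularSubdiff f x ⊆ convexSubdiff f x := by
  rintro v ⟨h1, h2, h⟩
  obtain ⟨r, hr⟩ : ∃ r : ℝ, f x = r := ⟨_, (EReal.coe_toReal h1 h2).symm⟩
  refine ⟨r, hr, fun y s hs => ?_⟩
  simp only [hr, EReal.toReal_coe] at h
  have key : ∀ ε : ℝ, 0 < ε → r + inner ℝ v (y - x) ≤ s + ε * ‖y - x‖ := by
    intro ε hε
    have hc : Tendsto (fun t : ℝ => x + t • (y - x)) (𝓝[>] 0) (𝓝 x) := by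
      have : Continuous fun t : ℝ => x + t • (y - x) := by fun_prop
      simpa using (this.tendsto 0).mono_left nhdsWithin_le_nhds
    obtain ⟨t, ht, ht0, ht1⟩ := ((hc.eventually (h ε hε)).and
      ((eventually_mem_nhdsWithin).and
        (nhdsWithin_le_nhds (Iio_mem_nhds (zero_lt_one' ℝ))))).exists
    have ht0 : 0 < t := ht0
    have h3 := ht.trans (hf.segment_le hr.le hs ht0.le (le_of_lt ht1))
    rw [EReal.coe_le_coe_iff] at h3
    simp only [add_sub_cancel_left, inner_smul_right, norm_smul, Real.norm_eq_abs,
      abs_of_pos ht0] at h3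
    have : t * (r + inner ℝ v (y - x)) ≤ t * (s + ε * ‖y - x‖) := by linarith
    exact le_of_mul_le_mul_left this ht0
  refine le_of_forall_pos_le_add fun ε hε => ?_
  have h4 := key (ε / (‖y - x‖ + 1)) (by positivity)
  have : ε / (‖y - x‖ + 1) * ‖y - x‖ ≤ ε := by
    rw [div_mul_eq_mul_div, div_le_iff₀ (by positivity)]
    nlinarith [norm_nonneg (y - x)]
  linarith

/-- The limiting and the convex subdifferential of a convex function coincide. -/
lemma ConvexFun.basicSubdiff_eq {f : E → EReal} (hf : ConvexFun f) :
    basicSubdiff f = convexSubdiff f := by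
  funext x
  refine Set.Subset.antisymm ?_ ((convexSubdiff_subset_regularSubdiff f x).trans
    (regularSubdiff_subset_basicSubdiff f x))
  rintro v ⟨h1, h2, xs, vs, hxs, hfx, hreg, hvs⟩
  obtain ⟨r, hr⟩ : ∃ r : ℝ, f x = r := ⟨_, (EReal.coe_toReal h1 h2).symm⟩
  choose rs hrs hsub using fun k => hf.regularSubdiff_subset _ (hreg k)
  refine ⟨r, hr, fun y s hs => ?_⟩
  simp only [hrs, hr] at hfx
  have hrt : Tendsto rs atTop (𝓝 r) := EReal.tendsto_coe.1 hfx
  exact le_of_tendsto (hrt.add (hvs.inner (tendsto_const_nhds.sub hxs)))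
    (Eventually.of_forall fun k => hsub k y s hs)

lemma convex_convexSubdiff (f : E → EReal) (x : E) : Convex ℝ (convexSubdiff f x) := by
  rintro v ⟨r, hr, h⟩ w ⟨r', hr', h'⟩ a b ha hb hab
  obtain rfl : r = r' := by rw [hr] at hr'; exact_mod_cast hr'
  refine ⟨r, hr, fun y s hs => ?_⟩
  have h1 := mul_le_mul_of_nonneg_left (h y s hs) ha
  have h2 := mul_le_mul_of_nonneg_left (h' y s hs) hb
  rw [inner_add_left, real_inner_smul_left, real_inner_smul_left]
  have e1 : r = a * r + b * r := by rw [← add_mul, hab, one_mul]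
  have e2 : s = a * s + b * s := by rw [← add_mul, hab, one_mul]
  linarith

end Convex

/-! ### Local structure of polyhedral convex functions -/

section Polyhedral

variable {E : Type*} [NormedAddCommGroup E] [InnerProductSpace ℝ E]

/-- Near each of its points `z₀` a polyhedral set is a cone with apex `z₀`; near a point outside, it
is empty. -/
lemma PolyhedralSet.eventually_conic {P : Set E} (hP : PolyhedralSet P) (z₀ : E) :
    ∀ᶠ δ : ℝ in 𝓝[>] 0, ∀ z ∈ P, ‖z - z₀‖ < δ →
      z₀ ∈ P ∧ ∀ t : ℝ, 0 ≤ t → t * ‖z - z₀‖ < δ → z₀ + t • (z - z₀) ∈ P := by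
  obtain ⟨k, a, b, rfl⟩ := hP
  have key : ∀ i, ∀ᶠ δ : ℝ in 𝓝[>] 0, ∀ z, inner ℝ (a i) z ≤ b i → ‖z - z₀‖ < δ →
      inner ℝ (a i) z₀ ≤ b i ∧ ∀ t : ℝ, 0 ≤ t → t * ‖z - z₀‖ < δ →
        inner ℝ (a i) (z₀ + t • (z - z₀)) ≤ b i := by
    intro i
    have hcont : Continuous fun z : E => (inner ℝ (a i) z : ℝ) := by fun_prop
    rcases lt_trichotomy (inner ℝ (a i) z₀) (b i) with hlt | heq | hgt
    · obtain ⟨ε, hε, hb⟩ := Metric.eventually_nhds_iff.1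
        (hcont.continuousAt.eventually (Iio_mem_nhds hlt))
      filter_upwards [Ioo_mem_nhdsGT hε] with δ hδ z _ _
      refine ⟨hlt.le, fun t ht htz => le_of_lt (hb ?_)⟩
      rw [dist_eq_norm, add_sub_cancel_left, norm_smul, Real.norm_eq_abs, abs_of_nonneg ht]
      exact htz.trans hδ.2
    · refine Eventually.of_forall fun δ z hz _ => ⟨heq.le, fun t ht _ => ?_⟩
      rw [inner_add_right, inner_smul_right, inner_sub_right]
      nlinarith
    · obtain ⟨ε, hε, hb⟩ := Metric.eventually_nhds_iff.1
        (hcont.continuousAt.eventually (Ioi_mem_nhds hgt))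
      filter_upwards [Ioo_mem_nhdsGT hε] with δ hδ z hz hzδ
      have : b i < inner ℝ (a i) z := hb (by rw [dist_eq_norm]; exact hzδ.trans hδ.2)
      linarith
  filter_upwards [eventually_all.2 key] with δ h z hz hzδ
  exact ⟨fun i => (h i z (hz i) hzδ).1, fun t ht htz i => (h i z (hz i) hzδ).2 t ht htz⟩

/-- On the part of each ray from `z₀` inside the open ball of radius `δ`, either `f` is affine or
`f = ⊤` except possibly at `z₀`. -/
def RadiallyAffine (f : E → EReal) (z₀ : E) (δ : ℝ) : Prop :=
  ∀ z, f z < ⊤ → ‖z - z₀‖ < δ → ∃ r c : ℝ, f z₀ = r ∧ f z = ((r + c : ℝ) : EReal) ∧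
    ∀ t : ℝ, 0 ≤ t → t * ‖z - z₀‖ < δ → f (z₀ + t • (z - z₀)) = ((r + t * c : ℝ) : EReal)

lemma PiecewiseLinear.exists_radiallyAffine {f : E → EReal} (hf : PiecewiseLinear f) (z₀ : E) :
    ∃ δ > 0, RadiallyAffine f z₀ δ := by
  obtain ⟨k, P, a, α, hP, hdom, hval⟩ := hf
  obtain ⟨δ, h, hδ⟩ := ((eventually_all.2 fun i => (hP i).eventually_conic z₀).and
    (eventually_mem_nhdsWithin (s := Set.Ioi (0 : ℝ)))).exists
  refine ⟨δ, hδ, fun z hz hzδ => ?_⟩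
  obtain ⟨i, hi⟩ : ∃ i, z ∈ P i := by
    have : z ∈ {x | f x < ⊤} := hz
    rw [hdom] at this
    simpa using this
  obtain ⟨h0, ht⟩ := h i z hi hzδ
  refine ⟨_, inner ℝ (a i) (z - z₀), hval i z₀ h0, ?_, fun t ht0 htz => ?_⟩
  · rw [hval i z hi, inner_sub_right]
    congr 1
    ring
  · rw [hval i _ (ht t ht0 htz), inner_add_right, inner_smul_right]
    congr 1
    ring

/-- Subgradients at nearby points are subgradients at the centre: the affine behaviour on rays
turns the subgradient inequality at `z₀ + 2 • (z - z₀)` into an equality between `z` and `z₀`. -/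
lemma RadiallyAffine.convexSubdiff_subset {f : E → EReal} {z₀ z : E} {δ : ℝ}
    (hf : RadiallyAffine f z₀ δ) (hz : ‖z - z₀‖ < δ / 2) :
    convexSubdiff f z ⊆ convexSubdiff f z₀ := by
  rintro v ⟨r, hr, h⟩
  obtain ⟨r₀, c, h0, h1, h2⟩ := hf z (by simp [hr]) (by linarith [norm_nonneg (z - z₀)])
  obtain rfl : r = r₀ + c := by rw [hr] at h1; exact_mod_cast h1
  have h3 := h _ _ (h2 2 (by norm_num) (by linarith)).le
  rw [show z₀ + (2 : ℝ) • (z - z₀) - z = z - z₀ by rw [two_smul]; abel] at h3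
  refine ⟨r₀, h0, fun y s hs => ?_⟩
  have h4 := h y s hs
  rw [show y - z = (y - z₀) - (z - z₀) by abel, inner_sub_right] at h4
  linarith

/-- The cone of feasible directions at `(z₀, r₀)` of the epigraph of `f`. For a convex radially
affine `f` with `f z₀ = r₀` it is closed, hence the tangent cone of the epigraph. -/
def epiCone (f : E → EReal) (z₀ : E) (r₀ : ℝ) : Set (E × ℝ) :=
  {p | ∃ t : ℝ, 0 < t ∧ f (z₀ + t • p.1) ≤ ((r₀ + t * p.2 : ℝ) : EReal)}

section EpiCone

variable {f : E → EReal} {z₀ : E} {δ r₀ : ℝ}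

lemma epiCone_smul {p : E × ℝ} (hp : p ∈ epiCone f z₀ r₀) {c : ℝ} (hc : 0 < c) :
    c • p ∈ epiCone f z₀ r₀ := by
  obtain ⟨t, ht, h⟩ := hp
  refine ⟨t / c, by positivity, ?_⟩
  simp only [Prod.smul_fst, Prod.smul_snd, smul_smul, smul_eq_mul]
  rwa [div_mul_cancel₀ _ hc.ne', ← mul_assoc, div_mul_cancel₀ _ hc.ne']

/-- In the definition of `epiCone` the step can be any one that stays within the radius. -/
lemma RadiallyAffine.le_of_mem_epiCone (hf : RadiallyAffine f z₀ δ) (hc : ConvexFun f)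
    (h0 : f z₀ = r₀) {p : E × ℝ} (hp : p ∈ epiCone f z₀ r₀) {t : ℝ} (ht : 0 < t)
    (htp : t * ‖p.1‖ < δ) : f (z₀ + t • p.1) ≤ ((r₀ + t * p.2 : ℝ) : EReal) := by
  obtain ⟨t₁, ht₁, h⟩ := hp
  set t₂ := min t₁ t
  have ht₂ : 0 < t₂ := lt_min ht₁ ht
  have h2 := hc.segment_le h0.le h (t := t₂ / t₁) (by positivity)
    ((div_le_one ht₁).2 (min_le_left _ _))
  rw [add_sub_cancel_left, smul_smul, div_mul_cancel₀ _ ht₁.ne',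
    show r₀ + t₂ / t₁ * (r₀ + t₁ * p.2 - r₀) = r₀ + t₂ * p.2 by field_simp; ring] at h2
  have hn : ‖z₀ + t₂ • p.1 - z₀‖ = t₂ * ‖p.1‖ := by
    rw [add_sub_cancel_left, norm_smul, Real.norm_eq_abs, abs_of_pos ht₂]
  obtain ⟨r, c, h3, h4, h5⟩ := hf (z₀ + t₂ • p.1) (h2.trans_lt (EReal.coe_lt_top _)) (by
    rw [hn]
    exact (mul_le_mul_of_nonneg_right (min_le_right _ _) (norm_nonneg _)).trans_lt htp)
  obtain rfl : r₀ = r := by rw [h0] at h3; exact_mod_cast h3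
  have h6 := h5 (t / t₂) (by positivity) (by
    rw [hn, ← mul_assoc, div_mul_cancel₀ _ ht₂.ne']; exact htp)
  rw [add_sub_cancel_left, smul_smul, div_mul_cancel₀ _ ht₂.ne'] at h6
  rw [h6, EReal.coe_le_coe_iff]
  rw [h4, EReal.coe_le_coe_iff] at h2
  have : t / t₂ * c ≤ t / t₂ * (t₂ * p.2) :=
    mul_le_mul_of_nonneg_left (by linarith) (by positivity)
  rw [← mul_assoc, div_mul_cancel₀ _ ht₂.ne'] at this
  linarith

lemma RadiallyAffine.convex_epiCone (hf : RadiallyAffine f z₀ δ) (hδ : 0 < δ) (hc : ConvexFun f)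
    (h0 : f z₀ = r₀) : Convex ℝ (epiCone f z₀ r₀) := by
  intro p hp q hq a b ha hb hab
  obtain ⟨t, ht, htp, htq⟩ : ∃ t : ℝ, 0 < t ∧ t * ‖p.1‖ < δ ∧ t * ‖q.1‖ < δ := by
    have h1 : ∀ x : E, δ / (‖p.1‖ + ‖q.1‖ + 1) * ‖x‖ < δ ↔ ‖x‖ < ‖p.1‖ + ‖q.1‖ + 1 := fun x => by
      rw [div_mul_eq_mul_div, div_lt_iff₀ (by positivity)]
      exact mul_lt_mul_iff_right₀ hδ
    refine ⟨δ / (‖p.1‖ + ‖q.1‖ + 1), by positivity, (h1 _).2 ?_, (h1 _).2 ?_⟩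
    · linarith [norm_nonneg q.1]
    · linarith [norm_nonneg p.1]
  refine ⟨t, ht, ?_⟩
  have h := hc.segment_le (hf.le_of_mem_epiCone hc h0 hp ht htp)
    (hf.le_of_mem_epiCone hc h0 hq ht htq) hb (by linarith)
  obtain rfl : a = 1 - b := by linarith
  simp only [Prod.fst_add, Prod.snd_add, Prod.smul_fst, Prod.smul_snd, smul_eq_mul]
  convert h using 2
  · module
  · ring

lemma RadiallyAffine.isClosed_epiCone (hf : RadiallyAffine f z₀ δ) (hδ : 0 < δ)
    (hc : ConvexFun f) (hl : LowerSemicontinuous f) (h0 : f z₀ = r₀) :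
    IsClosed (epiCone f z₀ r₀) := by
  refine IsSeqClosed.isClosed fun ps p hps hp => ?_
  set t := δ / (‖p.1‖ + 1)
  have ht : 0 < t := by positivity
  have htp : t * ‖p.1‖ < δ := by
    rw [div_mul_eq_mul_div, div_lt_iff₀ (by positivity)]
    nlinarith
  refine ⟨t, ht, ?_⟩
  have h1 : Tendsto (fun k => (ps k).1) atTop (𝓝 p.1) := (continuous_fst.tendsto p).comp hp
  have h2 : Tendsto (fun k => (ps k).2) atTop (𝓝 p.2) := (continuous_snd.tendsto p).comp hp
  have h3 : ∀ᶠ k in atTop, t * ‖(ps k).1‖ < δ :=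
    (h1.norm.const_mul t).eventually (Iio_mem_nhds htp)
  have hepi := hl.isClosed_epigraph
  have h4 : Tendsto (fun k => ((z₀ + t • (ps k).1, ((r₀ + t * (ps k).2 : ℝ) : EReal)) : E × EReal))
      atTop (𝓝 (z₀ + t • p.1, ((r₀ + t * p.2 : ℝ) : EReal))) :=
    ((h1.const_smul t).const_add z₀).prodMk_nhds
      (EReal.tendsto_coe.2 ((h2.const_mul t).const_add r₀))
  exact hepi.mem_of_tendsto h4 (h3.mono fun k hk => hf.le_of_mem_epiCone hc h0 (hps k) ht hk)

end EpiCone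

variable [CompleteSpace E]

/-- Orthogonally to the subspace parallel to `∂f(z₀)` the function is affine near `z₀`, with slope
any subgradient `v₀`. Otherwise a point of the graph, displaced along that affine function, could be
separated from the tangent cone of the epigraph; the separating functional yields a subgradient `w`
(or a recession direction `w - v₀` of `∂f(z₀)`) for which `w - v₀` is not orthogonal to the
displacement. -/
lemma RadiallyAffine.le_add_inner {f : E → EReal} {z₀ v₀ e d : E} {δ s : ℝ}
    (hf : RadiallyAffine f z₀ δ) (hδ : 0 < δ) (hc : ConvexFun f) (hl : LowerSemicontinuous f)
    (hv₀ : v₀ ∈ convexSubdiff f z₀)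
    (hd : d ∈ ((affineSpan ℝ (convexSubdiff f z₀)).direction)ᗮ)
    (hed : ‖e + d‖ < δ) (hs : f (z₀ + e) ≤ s) :
    f (z₀ + (e + d)) ≤ ((s + inner ℝ v₀ d : ℝ) : EReal) := by
  obtain ⟨r₀, h0, hsub⟩ := id hv₀
  by_contra hcon
  have hnot : ((e + d, s + inner ℝ v₀ d - r₀) : E × ℝ) ∉ epiCone f z₀ r₀ := fun hmem => by
    have := hf.le_of_mem_epiCone hc h0 hmem one_pos (by simpa using hed)
    simp only [one_smul, one_mul, add_sub_cancel] at this
    exact hcon this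
  obtain ⟨F, u, hFu, huF⟩ := geometric_hahn_banach_closed_point (hf.convex_epiCone hδ hc h0)
    (hf.isClosed_epiCone hδ hc hl h0) hnot
  have hu : 0 < u := by
    have := hFu 0 ⟨1, one_pos, by simp [h0]⟩
    simpa using this
  have hneg : ∀ p ∈ epiCone f z₀ r₀, F p ≤ 0 := by
    intro p hp
    by_contra! hpos
    have := hFu _ (epiCone_smul hp (c := u / F p) (by positivity))
    rw [map_smul, smul_eq_mul, div_mul_cancel₀ _ hpos.ne'] at this
    exact lt_irrefl _ this
  set w := (InnerProductSpace.toDual ℝ E).symm (F.comp (ContinuousLinearMap.inl ℝ E ℝ))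
  set β := F (0, 1)
  have hF : ∀ x a, F (x, a) = inner ℝ w x + a * β := by
    intro x a
    have : ((x, a) : E × ℝ) = (x, 0) + a • (0, 1) := by simp
    rw [this, map_add, map_smul, smul_eq_mul, InnerProductSpace.toDual_symm_apply]
    simp [β]
  have hβ : β ≤ 0 := by
    refine hneg _ ⟨1, one_pos, ?_⟩
    simp only [smul_zero, add_zero, h0, EReal.coe_le_coe_iff]
    linarith
  have hepi : ∀ (y : E) (a : ℝ), f y ≤ a → inner ℝ w (y - z₀) + (a - r₀) * β ≤ 0 := by
    intro y a hy
    rw [← hF]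
    refine hneg _ ⟨1, one_pos, ?_⟩
    simpa using hy
  have hmem : ∀ v ∈ convexSubdiff f z₀, inner ℝ (v - v₀) d = 0 := fun v hv =>
    hd _ (AffineSubspace.vsub_mem_direction (subset_affineSpan ℝ _ hv)
      (subset_affineSpan ℝ _ hv₀))
  have hse := hepi _ _ hs
  rw [add_sub_cancel_left] at hse
  rw [hF, inner_add_right] at huF
  rcases hβ.lt_or_eq with hβ | hβ
  · have hw : (-β)⁻¹ • w ∈ convexSubdiff f z₀ := by
      refine ⟨r₀, h0, fun y a hy => ?_⟩
      have h1 := hepi y a hy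
      rw [real_inner_smul_left]
      have : (-β)⁻¹ * inner ℝ w (y - z₀) ≤ (-β)⁻¹ * ((a - r₀) * (-β)) :=
        mul_le_mul_of_nonneg_left (by linarith) (by rw [inv_nonneg]; linarith)
      have e : (-β)⁻¹ * ((a - r₀) * (-β)) = a - r₀ := by
        rw [mul_comm, mul_assoc, mul_inv_cancel₀ (neg_ne_zero.2 hβ.ne), mul_one]
      linarith
    have h2 := hmem _ hw
    rw [inner_sub_left, real_inner_smul_left, sub_eq_zero,
      inv_mul_eq_iff_eq_mul₀ (neg_ne_zero.2 hβ.ne)] at h2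
    linarith
  · have hw : v₀ + w ∈ convexSubdiff f z₀ := by
      refine ⟨r₀, h0, fun y a hy => ?_⟩
      have h1 := hepi y a hy
      have h2 := hsub y a hy
      rw [hβ, mul_zero, add_zero] at h1
      rw [inner_add_left]
      linarith
    have h2 := hmem _ hw
    rw [add_sub_cancel_left] at h2
    rw [hβ] at hse huF
    linarith

/-- Near `z₀` the subdifferential mapping is invariant under displacements orthogonal to the
subspace parallel to `∂f(z₀)`. -/
lemma RadiallyAffine.convexSubdiff_subset_of_sub_mem {f : E → EReal} {z₀ z z' : E} {δ : ℝ}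
    (hf : RadiallyAffine f z₀ δ) (hδ : 0 < δ) (hc : ConvexFun f) (hl : LowerSemicontinuous f)
    (hz : ‖z - z₀‖ < δ / 2) (hz' : ‖z' - z₀‖ < δ)
    (hd : z' - z ∈ ((affineSpan ℝ (convexSubdiff f z₀)).direction)ᗮ) :
    convexSubdiff f z ⊆ convexSubdiff f z' := by
  intro v hv
  have hv0 := hf.convexSubdiff_subset hz hv
  obtain ⟨r, hr, h⟩ := hv
  have h1 : f z' ≤ ((r + inner ℝ v (z' - z) : ℝ) : EReal) := by
    have := hf.le_add_inner hδ hc hl hv0 hd (e := z - z₀) (s := r)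
      (by rwa [sub_add_sub_cancel']) (by simp [hr])
    simpa using this
  have h2 : f z' = ((r + inner ℝ v (z' - z) : ℝ) : EReal) :=
    le_antisymm h1 (coe_le_of_forall_real fun s hs => h z' s hs)
  refine ⟨_, h2, fun y s hs => ?_⟩
  have := h y s hs
  rw [show y - z = (z' - z) + (y - z') by abel, inner_add_right] at this
  linarith

end Polyhedral

/-! ### Derivatives of the adjoint Jacobian -/

section Jacobian

variable {E G : Type*} [NormedAddCommGroup E] [InnerProductSpace ℝ E] [CompleteSpace E]
  [NormedAddCommGroup G] [InnerProductSpace ℝ G] [CompleteSpace G]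

lemma jacAdjoint_inner_left (h : E → G) (x : E) (v : G) (d : E) :
    inner ℝ (jacAdjoint h x v) d = inner ℝ v (fderiv ℝ h x d) :=
  ContinuousLinearMap.adjoint_inner_left _ _ _

lemma jacAdjoint_inner_right (h : E → G) (x : E) (v : G) (d : E) :
    inner ℝ d (jacAdjoint h x v) = inner ℝ (fderiv ℝ h x d) v :=
  ContinuousLinearMap.adjoint_inner_right _ _ _

lemma isBoundedLinearMap_adjoint :
    IsBoundedLinearMap ℝ (fun A : E →L[ℝ] G => ContinuousLinearMap.adjoint A) where
  map_add A B := map_add _ A B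
  map_smul c A := by simp
  bound := ⟨1, one_pos, fun A => by simp⟩

lemma contDiffAt_jacAdjoint {h : E → G} {x : E} (hh : ContDiffAt ℝ 2 h x) :
    ContDiffAt ℝ 1 (jacAdjoint h) x :=
  isBoundedLinearMap_adjoint.contDiff.contDiffAt.comp x
    (hh.fderiv_right (m := 1) (by norm_num [one_add_one_eq_two]))

lemma continuousAt_jacAdjoint {h : E → G} {x : E} (hh : ContDiffAt ℝ 1 h x) :
    ContinuousAt (jacAdjoint h) x :=
  isBoundedLinearMap_adjoint.continuous.continuousAt.comp
    (hh.continuousAt_fderiv one_ne_zero)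

lemma gradient_inner {h : E → G} {x : E} (hh : DifferentiableAt ℝ h x) (v : G) :
    gradient (fun x' => inner ℝ v (h x')) x = jacAdjoint h x v := by
  refine HasGradientAt.gradient ?_
  rw [hasGradientAt_iff_hasFDerivAt]
  have := (innerSL ℝ v).hasFDerivAt.comp x hh.hasFDerivAt
  have e : InnerProductSpace.toDual ℝ E (jacAdjoint h x v) = (innerSL ℝ v).comp (fderiv ℝ h x) := by
    ext d
    simp [jacAdjoint_inner_left]
  rw [e]
  exact this

/-- The scalarized Hessian is the derivative of the adjoint Jacobian, with the two arguments
exchanged. -/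
lemma scalarizedHessian_apply {h : E → G} {x : E} (hh : ContDiffAt ℝ 2 h x) (v : G) (u : E) :
    scalarizedHessian h v x u = fderiv ℝ (jacAdjoint h) x u v := by
  have h1 : (gradient fun x' => inner ℝ v (h x')) =ᶠ[𝓝 x] fun x' => jacAdjoint h x' v := by
    filter_upwards [hh.eventually (by simp)] with x' hx'
    exact gradient_inner (hx'.differentiableAt two_ne_zero) v
  have h2 : HasFDerivAt (jacAdjoint h) (fderiv ℝ (jacAdjoint h) x) x :=
    ((contDiffAt_jacAdjoint hh).differentiableAt one_ne_zero).hasFDerivAt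
  rw [scalarizedHessian, h1.fderiv_eq, (h2.clm_apply (hasFDerivAt_const v x)).fderiv]
  simp

/-- Symmetry of the scalarized Hessian. -/
lemma inner_fderiv_jacAdjoint_comm {h : E → G} {x : E} (hh : ContDiffAt ℝ 2 h x) (v : G)
    (a b : E) :
    inner ℝ (fderiv ℝ (jacAdjoint h) x a v) b = inner ℝ a (fderiv ℝ (jacAdjoint h) x b v) := by
  have h2 : HasFDerivAt (jacAdjoint h) (fderiv ℝ (jacAdjoint h) x) x :=
    ((contDiffAt_jacAdjoint hh).differentiableAt one_ne_zero).hasFDerivAt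
  have h3 : HasFDerivAt (fderiv ℝ h) (fderiv ℝ (fderiv ℝ h) x) x :=
    ((hh.fderiv_right (m := 1) (by norm_num [one_add_one_eq_two])).differentiableAt
      one_ne_zero).hasFDerivAt
  have key : ∀ a b, inner ℝ (fderiv ℝ (jacAdjoint h) x a v) b
      = inner ℝ v (fderiv ℝ (fderiv ℝ h) x a b) := by
    intro a b
    have h4 := (h2.clm_apply (hasFDerivAt_const v x)).inner ℝ (hasFDerivAt_const b x)
    have h5 := (hasFDerivAt_const v x).inner ℝ (h3.clm_apply (hasFDerivAt_const b x))
    simp only [jacAdjoint_inner_left] at h4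
    simpa using DFunLike.congr_fun (h4.unique h5) a
  have hsymm := hh.isSymmSndFDerivAt (by simp) a b
  rw [key, hsymm, ← key b a, real_inner_comm]

/-- First-order expansion of the pairing that defines normals to the graph of
`x ↦ ∇h(x)* F(h x)`: up to `o(‖x' - x‖ + ‖v' - v‖)`, the terms of second order in `h` cancel against
the Hessian. -/
lemma eventually_pairing_le {h : E → G} {x : E} (hh : ContDiffAt ℝ 2 h x) (u w : E) (v : G)
    {ε : ℝ} (hε : 0 < ε) :
    ∀ᶠ x' in 𝓝 x, ∀ v' : G,
      |(inner ℝ (fderiv ℝ (jacAdjoint h) x u v + w) (x' - x)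
          - inner ℝ u (jacAdjoint h x' v' - jacAdjoint h x v))
        - (inner ℝ w (x' - x) - inner ℝ (fderiv ℝ h x u) (v' - v))|
        ≤ ε * (‖x' - x‖ + ‖v' - v‖) := by
  set ε₁ := ε / ((‖u‖ + 1) * (‖v‖ + 1))
  have hε₁ : 0 < ε₁ := by positivity
  have e1 : ε₁ * (‖u‖ * ‖v‖) ≤ ε := by
    rw [div_mul_eq_mul_div, div_le_iff₀ (by positivity)]
    nlinarith [norm_nonneg u, norm_nonneg v, mul_nonneg (norm_nonneg u) (norm_nonneg v)]
  have e2 : ε₁ * ‖u‖ ≤ ε := by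
    rw [div_mul_eq_mul_div, div_le_iff₀ (by positivity)]
    nlinarith [norm_nonneg u, norm_nonneg v, mul_nonneg (norm_nonneg u) (norm_nonneg v)]
  have hJ : ∀ᶠ x' in 𝓝 x, ‖jacAdjoint h x' - jacAdjoint h x‖ ≤ ε₁ := by
    have := (contDiffAt_jacAdjoint hh).continuousAt.eventually
      (Metric.closedBall_mem_nhds (jacAdjoint h x) hε₁)
    simpa [dist_eq_norm] using this
  have hD := (((contDiffAt_jacAdjoint hh).differentiableAt one_ne_zero).hasFDerivAt.isLittleO).def
    hε₁
  filter_upwards [hJ, hD] with x' hJ hD v'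
  set Q := fderiv ℝ (jacAdjoint h) x
  have hA : ‖(jacAdjoint h x' - jacAdjoint h x - Q (x' - x)) v‖ ≤ ε₁ * ‖x' - x‖ * ‖v‖ :=
    ContinuousLinearMap.le_of_opNorm_le _ hD v
  have hB : ‖(jacAdjoint h x' - jacAdjoint h x) (v' - v)‖ ≤ ε₁ * ‖v' - v‖ :=
    ContinuousLinearMap.le_of_opNorm_le _ hJ _
  have hid : (inner ℝ (Q u v + w) (x' - x)
          - inner ℝ u (jacAdjoint h x' v' - jacAdjoint h x v))
        - (inner ℝ w (x' - x) - inner ℝ (fderiv ℝ h x u) (v' - v))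
      = - inner ℝ u ((jacAdjoint h x' - jacAdjoint h x - Q (x' - x)) v
          + (jacAdjoint h x' - jacAdjoint h x) (v' - v)) := by
    rw [inner_add_left, inner_fderiv_jacAdjoint_comm hh, ← jacAdjoint_inner_right]
    simp only [sub_apply, map_sub, inner_add_right, inner_sub_right]
    ring
  rw [hid, abs_neg]
  refine (abs_real_inner_le_norm _ _).trans ?_
  have h3 := (norm_add_le _ _).trans (add_le_add hA hB)
  calc _ ≤ ‖u‖ * (ε₁ * ‖x' - x‖ * ‖v‖ + ε₁ * ‖v' - v‖) :=
        mul_le_mul_of_nonneg_left h3 (norm_nonneg u)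
    _ = ε₁ * (‖u‖ * ‖v‖) * ‖x' - x‖ + ε₁ * ‖u‖ * ‖v' - v‖ := by ring
    _ ≤ ε * ‖x' - x‖ + ε * ‖v' - v‖ := by gcongr
    _ = _ := by ring

end Jacobian

/-! ### Coercivity and metric regularity -/

section Regularity

variable {E G : Type*} [NormedAddCommGroup E] [InnerProductSpace ℝ E]
  [NormedAddCommGroup G] [InnerProductSpace ℝ G]

/-- Injectivity on a finite-dimensional subspace is uniform and stable under perturbations. -/
lemma exists_eventually_norm_le [FiniteDimensional ℝ G] (L : Submodule ℝ G) (B : G →L[ℝ] E)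
    (hB : ∀ s ∈ L, B s = 0 → s = 0) :
    ∃ c : ℝ, 0 < c ∧ ∀ᶠ B' in 𝓝 B, ∀ s ∈ L, ‖s‖ ≤ c * ‖B' s‖ := by
  obtain ⟨K, hK, hanti⟩ := ((B.comp L.subtypeL).toLinearMap.injective_iff_antilipschitz).1 (by
    rw [injective_iff_map_eq_zero]
    intro s hs
    exact Subtype.ext (hB s s.2 hs))
  have hK' : (0 : ℝ) < K := hK
  refine ⟨2 * K, by positivity, ?_⟩
  filter_upwards [Metric.closedBall_mem_nhds B (show (0 : ℝ) < 1 / (2 * K) by positivity)]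
    with B' hB' s hs
  have h1 := hanti.le_mul_dist (⟨s, hs⟩ : L) 0
  simp only [map_zero, dist_zero_right] at h1
  have h1 : ‖s‖ ≤ K * ‖B s‖ := h1
  rw [Metric.mem_closedBall, dist_eq_norm] at hB'
  have h2 : ‖B s‖ ≤ ‖B' s‖ + ‖(B' - B) s‖ := by
    have := norm_sub_le (B' s) ((B' - B) s)
    simpa using this
  have h3 := ContinuousLinearMap.le_of_opNorm_le _ hB' s
  have h4 : K * ‖B s‖ ≤ K * (‖B' s‖ + 1 / (2 * K) * ‖s‖) :=
    mul_le_mul_of_nonneg_left (by linarith) hK'.le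
  have h5 : K * (‖B' s‖ + 1 / (2 * K) * ‖s‖) = K * ‖B' s‖ + ‖s‖ / 2 := by
    field_simp
  linarith

/-- If the adjoint of `A` is bounded below on `L`, then `A` followed by the projection onto `L` is
onto, with the same constant. -/
lemma exists_projection_apply_eq [CompleteSpace E] [FiniteDimensional ℝ G] [CompleteSpace G]
    (L : Submodule ℝ G) (A : E →L[ℝ] G) {c : ℝ}
    (hA : ∀ s ∈ L, ‖s‖ ≤ c * ‖ContinuousLinearMap.adjoint A s‖) (s : L) :
    ∃ d : E, L.orthogonalProjectionOnto (A d) = s ∧ ‖d‖ ≤ c * ‖s‖ := by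
  set B : L →L[ℝ] E := (ContinuousLinearMap.adjoint A).comp L.subtypeL
  set T : L →L[ℝ] L := (L.orthogonalProjectionOnto.comp A).comp B
  have hT : ∀ s : L, inner ℝ (T s) s = ‖B s‖ ^ 2 := by
    intro s
    have : inner ℝ (T s) s = inner ℝ (A (B s)) (s : G) := by
      change inner ℝ (L.orthogonalProjectionOnto (A (B s))) s = _
      rw [Submodule.inner_orthogonalProjectionOnto_eq_of_mem_right]
    rw [this, ← ContinuousLinearMap.adjoint_inner_right, ← real_inner_self_eq_norm_sq]
    rfl
  have hinj : Function.Injective T.toLinearMap := by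
    rw [injective_iff_map_eq_zero]
    intro s hs
    have h1 := hT s
    have hs : T s = 0 := hs
    rw [hs, inner_zero_left] at h1
    have h2 : ‖B s‖ = 0 := by simpa using h1.symm
    have h3 : ‖(s : G)‖ ≤ c * ‖B s‖ := hA s s.2
    rw [h2, mul_zero] at h3
    exact Subtype.ext (norm_le_zero_iff.1 h3)
  obtain ⟨s', hs'⟩ := (LinearMap.injective_iff_surjective.1 hinj) s
  have hs' : T s' = s := hs'
  refine ⟨B s', hs', ?_⟩
  have h1 := hT s'
  rw [hs'] at h1
  have h2 : ‖s'‖ ≤ c * ‖B s'‖ := hA s' s'.2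
  have h3 := real_inner_le_norm s s'
  rcases (norm_nonneg (B s')).eq_or_lt with h0 | h0
  · rw [← h0] at h2 ⊢
    have : s' = 0 := norm_le_zero_iff.1 (by simpa using h2)
    rw [← hs', this]
    simp
  · have h4 : ‖B s'‖ * ‖B s'‖ ≤ (c * ‖s‖) * ‖B s'‖ := by
      have := mul_le_mul_of_nonneg_left h2 (norm_nonneg s)
      nlinarith
    exact le_of_mul_le_mul_right h4 h0

end Regularity

/-- **Graves' theorem**: a strictly differentiable map with surjective derivative is metrically
regular. -/
lemma exists_eventually_metricRegular {E F : Type*} [NormedAddCommGroup E] [NormedSpace ℝ E]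
    [CompleteSpace E] [NormedAddCommGroup F] [NormedSpace ℝ F] [CompleteSpace F] {f : E → F}
    {f' : E →L[ℝ] F} {a : E} (hf : HasStrictFDerivAt f f' a) (hsurj : f'.range = ⊤) :
    ∃ κ : ℝ, 0 < κ ∧ ∀ᶠ p : E × F in 𝓝 (a, f a), ∃ x', f x' = p.2 ∧
      ‖x' - p.1‖ ≤ κ * ‖p.2 - f p.1‖ := by
  set R := f'.nonlinearRightInverseOfSurjective hsurj
  have hR : 0 < R.nnnorm := f'.nonlinearRightInverseOfSurjective_nnnorm_pos hsurj
  set c : NNReal := R.nnnorm⁻¹ / 2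
  obtain ⟨s, hs, happ⟩ := hf.approximates_deriv_on_nhds (c := c) (Or.inr (by positivity))
  obtain ⟨ρ, hρ, hρs⟩ := Metric.mem_nhds_iff.1 hs
  have hR' : (0 : ℝ) < R.nnnorm := hR
  set κ : ℝ := 2 * R.nnnorm
  have hκ : ((R.nnnorm : ℝ)⁻¹ - c) = κ⁻¹ := by
    simp only [c, κ, NNReal.coe_div, NNReal.coe_inv, NNReal.coe_ofNat]
    field_simp
    norm_num
  have hκ0 : 0 < κ := by positivity
  refine ⟨κ, hκ0, ?_⟩
  have hcont : Tendsto (fun p : E × F => dist p.1 a + κ * ‖p.2 - f p.1‖) (𝓝 (a, f a)) (𝓝 0) := by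
    have h1 : ContinuousAt (fun p : E × F => f p.1) (a, f a) :=
      ContinuousAt.comp (f := Prod.fst) (g := f) hf.continuousAt continuousAt_fst
    have : ContinuousAt (fun p : E × F => dist p.1 a + κ * ‖p.2 - f p.1‖) (a, f a) :=
      (continuousAt_fst.dist continuousAt_const).add
        (continuousAt_const.mul (continuousAt_snd.sub h1).norm)
    simpa [ContinuousAt] using this
  filter_upwards [hcont.eventually (Iio_mem_nhds hρ)] with p hp
  have hp : dist p.1 a + κ * ‖p.2 - f p.1‖ < ρ := hp
  have hsub : Metric.closedBall p.1 (κ * ‖p.2 - f p.1‖) ⊆ s := by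
    refine Set.Subset.trans (fun y hy => ?_) hρs
    rw [Metric.mem_ball]
    linarith [dist_triangle y p.1 a, Metric.mem_closedBall.1 hy]
  obtain ⟨x', hx', hfx'⟩ := happ.surjOn_closedBall_of_nonlinearRightInverse R
    (ε := κ * ‖p.2 - f p.1‖) (b := p.1) (by positivity) hsub (a := p.2) (by
      rw [Metric.mem_closedBall, dist_eq_norm, hκ, inv_mul_cancel_left₀ hκ0.ne'])
  exact ⟨x', hfx', by simpa [dist_eq_norm] using hx'⟩

/-! ### Normals to graphs -/

section GraphNormals

lemma norm_toLp_le {E G : Type*} [NormedAddCommGroup E] [NormedAddCommGroup G] (a : E) (b : G) :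
    ‖WithLp.toLp 2 (a, b)‖ ≤ ‖a‖ + ‖b‖ := by
  rw [WithLp.prod_norm_eq_of_L2]
  refine Real.sqrt_le_iff.2 ⟨by positivity, ?_⟩
  change ‖a‖ ^ 2 + ‖b‖ ^ 2 ≤ _
  nlinarith [mul_nonneg (norm_nonneg a) (norm_nonneg b)]

lemma le_norm_toLp {E G : Type*} [NormedAddCommGroup E] [NormedAddCommGroup G] (a : E) (b : G) :
    ‖a‖ + ‖b‖ ≤ 2 * ‖WithLp.toLp 2 (a, b)‖ := by
  have h1 : ‖a‖ ≤ _ := WithLp.norm_fst_le (p := 2) _ (WithLp.toLp 2 (a, b))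
  have h2 : ‖b‖ ≤ _ := WithLp.norm_snd_le (p := 2) _ (WithLp.toLp 2 (a, b))
  linarith

variable {E G : Type*} [NormedAddCommGroup E] [InnerProductSpace ℝ E]
  [NormedAddCommGroup G] [InnerProductSpace ℝ G]

/-- Regular normals to a graph, with the Euclidean norm of the product replaced by the equivalent
sum of norms. -/
lemma mem_regularNormalCone_gph_iff {F : E → Set G} {x a : E} {y b : G} :
    WithLp.toLp 2 (a, b) ∈ regularNormalCone (gph F) (WithLp.toLp 2 (x, y)) ↔
      y ∈ F x ∧ ∀ ε : ℝ, 0 < ε → ∀ᶠ p : E × G in 𝓝 (x, y), p.2 ∈ F p.1 →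
        inner ℝ a (p.1 - x) + inner ℝ b (p.2 - y) ≤ ε * (‖p.1 - x‖ + ‖p.2 - y‖) := by
  have hnhds : ∀ P : WithLp 2 (E × G) → Prop, (∀ᶠ q in 𝓝 (WithLp.toLp 2 (x, y)), P q) ↔
      ∀ᶠ p in 𝓝 (x, y), P (WithLp.toLp 2 p) := by
    intro P
    have := (WithLp.homeomorphProd 2 E G).symm.map_nhds_eq (x, y)
    change map (WithLp.toLp 2) (𝓝 (x, y)) = 𝓝 (WithLp.toLp 2 (x, y)) at this
    rw [← this, eventually_map]
  refine and_congr Iff.rfl ⟨fun h ε hε => ?_, fun h ε hε => ?_⟩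
  · have h1 := h ε hε
    rw [eventually_nhdsWithin_iff, hnhds] at h1
    filter_upwards [h1] with p hp hpF
    have h2 := hp hpF
    rw [WithLp.prod_inner_apply] at h2
    refine h2.trans (mul_le_mul_of_nonneg_left ?_ hε.le)
    exact norm_toLp_le (p.1 - x) (p.2 - y)
  · rw [eventually_nhdsWithin_iff, hnhds]
    filter_upwards [h (ε / 2) (by positivity)] with p hp hpF
    rw [WithLp.prod_inner_apply]
    refine (hp hpF).trans ?_
    have := le_norm_toLp (p.1 - x) (p.2 - y)
    calc ε / 2 * (‖p.1 - x‖ + ‖p.2 - y‖) ≤ ε / 2 * (2 * ‖WithLp.toLp 2 (p.1 - x, p.2 - y)‖) :=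
          mul_le_mul_of_nonneg_left this (by positivity)
      _ = ε * ‖WithLp.toLp 2 (p.1 - x, p.2 - y)‖ := by ring

lemma mem_coderivative_of_tendsto {F : E → Set G} {x w : E} {y u : G} (hy : y ∈ F x)
    {xs ws : ℕ → E} {ys us : ℕ → G} (hxs : Tendsto xs atTop (𝓝 x))
    (hys : Tendsto ys atTop (𝓝 y)) (hws : Tendsto ws atTop (𝓝 w)) (hus : Tendsto us atTop (𝓝 u))
    (hN : ∀ᶠ k in atTop, WithLp.toLp 2 (ws k, -us k) ∈
      regularNormalCone (gph F) (WithLp.toLp 2 (xs k, ys k))) :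
    w ∈ coderivative F x y u := by
  obtain ⟨N, hN⟩ := eventually_atTop.1 hN
  have hc := WithLp.prod_continuous_toLp 2 E G
  refine ⟨hy, fun k => WithLp.toLp 2 (xs (k + N), ys (k + N)),
    fun k => WithLp.toLp 2 (ws (k + N), -us (k + N)), ?_, fun k => hN _ (by omega), ?_⟩
  · exact (tendsto_add_atTop_iff_nat N (f := fun k => WithLp.toLp 2 (xs k, ys k))).2
      ((hc.tendsto _).comp (hxs.prodMk_nhds hys))
  · exact (tendsto_add_atTop_iff_nat N (f := fun k => WithLp.toLp 2 (ws k, -us k))).2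
      ((hc.tendsto _).comp (hws.prodMk_nhds hus.neg))

lemma exists_seq_of_mem_coderivative {F : E → Set G} {x w : E} {y u : G}
    (h : w ∈ coderivative F x y u) :
    ∃ (xs ws : ℕ → E) (ys us : ℕ → G), Tendsto xs atTop (𝓝 x) ∧ Tendsto ys atTop (𝓝 y) ∧
      Tendsto ws atTop (𝓝 w) ∧ Tendsto us atTop (𝓝 u) ∧
      ∀ k, WithLp.toLp 2 (ws k, -us k) ∈
        regularNormalCone (gph F) (WithLp.toLp 2 (xs k, ys k)) := by
  obtain ⟨-, ps, vs, hps, hN, hvs⟩ := h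
  have h1 := WithLp.continuous_fst 2 E G
  have h2 := WithLp.continuous_snd 2 E G
  refine ⟨fun k => (ps k).fst, fun k => (vs k).fst, fun k => (ps k).snd, fun k => -(vs k).snd,
    (h1.tendsto _).comp hps, (h2.tendsto _).comp hps, (h1.tendsto _).comp hvs, ?_, fun k => ?_⟩
  · simpa using ((h2.tendsto _).comp hvs).neg
  · rw [neg_neg]
    exact hN k

end GraphNormals

/-! ### Mappings invariant along the orthogonal complement of a subspace -/

section Invariant

variable {G : Type*} [NormedAddCommGroup G] [InnerProductSpace ℝ G]
  {F : G → Set G} {L : Submodule ℝ G} {z z' v a b b' : G}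

/-- A regular normal to the graph of a mapping invariant along `Lᗮ` has its first component in
`L`. -/
lemma mem_of_regularNormal_gph [L.HasOrthogonalProjection]
    (hF : ∀ᶠ p : G × G in 𝓝 (z, z), p.2 - p.1 ∈ Lᗮ → F p.1 ⊆ F p.2)
    (hN : WithLp.toLp 2 (a, b) ∈ regularNormalCone (gph F) (WithLp.toLp 2 (z, v))) : a ∈ L := by
  rw [← Submodule.orthogonal_orthogonal L]
  rw [mem_regularNormalCone_gph_iff] at hN
  obtain ⟨hv, hN⟩ := hN
  have key : ∀ d ∈ Lᗮ, inner ℝ a d ≤ 0 := by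
    intro d hd
    refine le_of_forall_pos_le_add fun ε hε => ?_
    have hlim : Tendsto (fun t : ℝ => z + t • d) (𝓝[>] 0) (𝓝 z) := by
      have : Continuous fun t : ℝ => z + t • d := by fun_prop
      simpa using (this.tendsto 0).mono_left nhdsWithin_le_nhds
    obtain ⟨t, ht1, ht2, ht⟩ := (((hlim.prodMk_nhds tendsto_const_nhds).eventually
      (hN (ε / (‖d‖ + 1)) (by positivity))).and
      (((tendsto_const_nhds.prodMk_nhds hlim).eventually hF).and
        eventually_mem_nhdsWithin)).exists
    have ht : 0 < t := ht
    simp only [add_sub_cancel_left, sub_self, inner_zero_right, norm_zero, add_zero,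
      inner_smul_right, norm_smul, Real.norm_eq_abs, abs_of_pos ht] at ht1 ht2
    have h3 := ht1 (ht2 (Submodule.smul_mem _ t hd) hv)
    have h4 : inner ℝ a d ≤ ε / (‖d‖ + 1) * ‖d‖ := by
      refine le_of_mul_le_mul_left ?_ ht
      linarith
    have h5 : ε / (‖d‖ + 1) * ‖d‖ ≤ ε := by
      rw [div_mul_eq_mul_div, div_le_iff₀ (by positivity)]
      nlinarith
    linarith
  rw [Submodule.mem_orthogonal']
  intro d hd
  have h1 := key d hd
  have h2 := key (-d) (Submodule.neg_mem _ hd)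
  rw [inner_neg_right] at h2
  linarith

/-- Regular normals to the graph of `F` do not change when the base point is moved along `Lᗮ`, nor
when their second component is. -/
lemma regularNormal_gph_translate
    (hF₁ : ∀ᶠ y in 𝓝 z', ∀ v' ∈ F y, v' - v ∈ L)
    (hF₂ : ∀ᶠ p : G × G in 𝓝 (z, z'), p.2 - p.1 ∈ Lᗮ → F p.1 ⊆ F p.2)
    (hF₃ : ∀ᶠ p : G × G in 𝓝 (z', z), p.2 - p.1 ∈ Lᗮ → F p.1 ⊆ F p.2)
    (hz : z' - z ∈ Lᗮ) (hb : b' - b ∈ Lᗮ)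
    (hN : WithLp.toLp 2 (a, b) ∈ regularNormalCone (gph F) (WithLp.toLp 2 (z, v))) :
    WithLp.toLp 2 (a, b') ∈ regularNormalCone (gph F) (WithLp.toLp 2 (z', v)) := by
  rw [mem_regularNormalCone_gph_iff] at hN ⊢
  obtain ⟨hv, hN⟩ := hN
  refine ⟨hF₂.self_of_nhds hz hv, fun ε hε => ?_⟩
  have hlim : Tendsto (fun p : G × G => p.1 - z' + z) (𝓝 (z', v)) (𝓝 z) := by
    have : Continuous fun p : G × G => p.1 - z' + z := by fun_prop
    simpa using this.tendsto (z', v)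
  filter_upwards [(hlim.prodMk_nhds (continuous_snd.tendsto _)).eventually (hN ε hε),
    ((continuous_fst.tendsto _).prodMk_nhds hlim).eventually hF₃,
    (continuous_fst.tendsto (z', v)).eventually hF₁] with p h1 h2 h3 hp
  have h4 := h1 (h2 (by
    rw [show p.1 - z' + z - p.1 = -(z' - z) by abel]; exact Submodule.neg_mem _ hz) hp)
  have h5 : inner ℝ (b' - b) (p.2 - v) = 0 :=
    Submodule.inner_left_of_mem_orthogonal (h3 _ hp) hb
  rw [inner_sub_left] at h5
  simp only [add_sub_cancel_right] at h4
  linarith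

end Invariant

/-! ### Regular normals to the graph of `x ↦ ∇h(x)* F(h x)` -/

section RegularLevel

variable {E G : Type*} [NormedAddCommGroup E] [InnerProductSpace ℝ E] [CompleteSpace E]
  [NormedAddCommGroup G] [InnerProductSpace ℝ G] [CompleteSpace G]
  {h : E → G} {x : E} {F : G → Set G} {Φ : E → Set E} {L : Submodule ℝ G} {v : G} {u w : E}

lemma eventually_norm_sub_le_of_differentiableAt {E F : Type*} [NormedAddCommGroup E]
    [NormedSpace ℝ E] [NormedAddCommGroup F] [NormedSpace ℝ F] {f : E → F} {x : E}
    (hf : DifferentiableAt ℝ f x) :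
    ∃ C : ℝ, 0 < C ∧ ∀ᶠ x' in 𝓝 x, ‖f x' - f x‖ ≤ C * ‖x' - x‖ := by
  obtain ⟨C, hC, h⟩ := hf.isBigO_sub.exists_pos
  exact ⟨C, hC, h.bound⟩

/-- Regular normals to the graph of `F` are carried to regular normals to the graph of the
composition. Coercivity of `∇h(x)*` on `L` bounds the multipliers of nearby points of the latter. -/
lemma regularNormal_comp_of_regularNormal (hh : ContDiffAt ℝ 2 h x) {c : ℝ} (hc0 : 0 < c)
    (hc : ∀ᶠ x' in 𝓝 x, ∀ s ∈ L, ‖s‖ ≤ c * ‖jacAdjoint h x' s‖)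
    (hF₁ : ∀ᶠ z in 𝓝 (h x), ∀ v' ∈ F z, v' - v ∈ L)
    (hΦ : ∀ᶠ x' in 𝓝 x, Φ x' = jacAdjoint h x' '' F (h x')) {q : G}
    (hN : WithLp.toLp 2 (q, -fderiv ℝ h x u) ∈
      regularNormalCone (gph F) (WithLp.toLp 2 (h x, v))) :
    WithLp.toLp 2 (fderiv ℝ (jacAdjoint h) x u v + jacAdjoint h x q, -u) ∈
      regularNormalCone (gph Φ) (WithLp.toLp 2 (x, jacAdjoint h x v)) := by
  rw [mem_regularNormalCone_gph_iff] at hN ⊢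
  obtain ⟨hv, hN⟩ := hN
  refine ⟨by rw [hΦ.self_of_nhds]; exact ⟨v, hv, rfl⟩, fun ε hε => ?_⟩
  have hdh : DifferentiableAt ℝ h x := hh.differentiableAt two_ne_zero
  have hdJ : DifferentiableAt ℝ (jacAdjoint h) x :=
    (contDiffAt_jacAdjoint hh).differentiableAt one_ne_zero
  obtain ⟨C₁, hC₁, hC₁'⟩ := eventually_norm_sub_le_of_differentiableAt hdh
  obtain ⟨C₂, hC₂, hC₂'⟩ := eventually_norm_sub_le_of_differentiableAt
    (hdJ.clm_apply (differentiableAt_const v))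
  set M := C₁ + 1 + ‖q‖ + 2 * (c * C₂) + 2 * c
  have hM : 0 < M := by positivity
  set η := ε / M
  have hη : 0 < η := by positivity
  obtain ⟨ρ, hρ, hball⟩ := Metric.eventually_nhds_iff.1 (hN η hη)
  have hsmall : ∀ᶠ p : E × E in 𝓝 (x, jacAdjoint h x v),
      c * (‖p.2 - jacAdjoint h x v‖ + C₂ * ‖p.1 - x‖) < ρ := by
    have : Continuous fun p : E × E => c * (‖p.2 - jacAdjoint h x v‖ + C₂ * ‖p.1 - x‖) := by
      fun_prop
    exact (this.tendsto _).eventually (Iio_mem_nhds (by simpa using hρ))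
  have hx : ∀ {P : E → Prop}, (∀ᶠ x' in 𝓝 x, P x') →
      ∀ᶠ p : E × E in 𝓝 (x, jacAdjoint h x v), P p.1 :=
    fun hP => (continuous_fst.tendsto (x, jacAdjoint h x v)).eventually hP
  filter_upwards [hsmall, hx hC₁', hx hC₂', hx hc, hx (hdh.continuousAt.eventually hF₁), hx hΦ,
    hx (hdh.continuousAt.eventually (Metric.ball_mem_nhds _ hρ)),
    hx (hdh.hasFDerivAt.isLittleO.def hη),
    hx (eventually_pairing_le hh u (jacAdjoint h x q) v hη)]
    with p hs h1 h2 h3 h4 h5 h6 h7 h8 hp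
  rw [h5] at hp
  obtain ⟨v', hv', hpv⟩ := hp
  set y := jacAdjoint h x v
  have hvv : ‖v' - v‖ ≤ c * (‖p.2 - y‖ + C₂ * ‖p.1 - x‖) := by
    refine (h3 _ (h4 _ hv')).trans (mul_le_mul_of_nonneg_left ?_ hc0.le)
    have : jacAdjoint h p.1 (v' - v) = (p.2 - y) - (jacAdjoint h p.1 v - y) := by
      rw [map_sub, ← hpv]; abel
    rw [this]
    exact (norm_sub_le _ _).trans (add_le_add le_rfl h2)
  have h9 := hball (y := (h p.1, v')) (by
    rw [Prod.dist_eq, max_lt_iff]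
    exact ⟨h6, by rw [dist_eq_norm]; exact hvv.trans_lt hs⟩) hv'
  have h10 := (abs_le.1 (h8 v')).2
  rw [hpv, jacAdjoint_inner_left _ _ _ (p.1 - x)] at h10
  have h11 : inner ℝ q (fderiv ℝ h x (p.1 - x)) ≤
      inner ℝ q (h p.1 - h x) + ‖q‖ * (η * ‖p.1 - x‖) := by
    have e1 := (real_inner_le_norm q (-(h p.1 - h x - fderiv ℝ h x (p.1 - x)))).trans
      (mul_le_mul_of_nonneg_left ((norm_neg _).trans_le h7) (norm_nonneg q))
    rw [inner_neg_right, inner_sub_right] at e1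
    linarith
  simp only [inner_neg_left] at h9 ⊢
  have h12 : η * (‖h p.1 - h x‖ + ‖v' - v‖) ≤ η * (C₁ * ‖p.1 - x‖ + ‖v' - v‖) := by gcongr
  have h13 : 2 * η * ‖v' - v‖ ≤ 2 * η * (c * (‖p.2 - y‖ + C₂ * ‖p.1 - x‖)) := by gcongr
  have h14 : 0 ≤ η * ‖p.2 - y‖ := by positivity
  have h15 : ε * (‖p.1 - x‖ + ‖p.2 - y‖) = η * M * (‖p.1 - x‖ + ‖p.2 - y‖) := by
    rw [div_mul_cancel₀ _ hM.ne']
  have h16 : 0 ≤ η * ((C₁ + 1 + ‖q‖ + 2 * (c * C₂)) * ‖p.2 - y‖ + 2 * c * ‖p.1 - x‖) := by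
    positivity
  rw [h15]
  simp only [M]
  nlinarith

/-- Conversely, regular normals to the graph of the composition are pulled back along the
parametrization `(x, v) ↦ (x, ∇h(x)* v)`. -/
lemma eventually_of_regularNormal_comp (hh : ContDiffAt ℝ 2 h x)
    (hΦ : ∀ᶠ x' in 𝓝 x, Φ x' = jacAdjoint h x' '' F (h x'))
    (hN : WithLp.toLp 2 (fderiv ℝ (jacAdjoint h) x u v + w, -u) ∈
      regularNormalCone (gph Φ) (WithLp.toLp 2 (x, jacAdjoint h x v))) {ε : ℝ} (hε : 0 < ε) :
    ∀ᶠ p : E × G in 𝓝 (x, v), p.2 ∈ F (h p.1) →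
      inner ℝ w (p.1 - x) - inner ℝ (fderiv ℝ h x u) (p.2 - v) ≤
        ε * (‖p.1 - x‖ + ‖p.2 - v‖) := by
  rw [mem_regularNormalCone_gph_iff] at hN
  obtain ⟨hv, hN⟩ := hN
  have hcJ := (contDiffAt_jacAdjoint hh).continuousAt
  have hdJ : DifferentiableAt ℝ (jacAdjoint h) x :=
    (contDiffAt_jacAdjoint hh).differentiableAt one_ne_zero
  obtain ⟨C₂, hC₂, hC₂'⟩ := eventually_norm_sub_le_of_differentiableAt
    (hdJ.clm_apply (differentiableAt_const v))
  set C₃ := ‖jacAdjoint h x‖ + 1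
  have hC₃ : ∀ᶠ x' in 𝓝 x, ‖jacAdjoint h x'‖ < C₃ :=
    hcJ.norm.eventually (Iio_mem_nhds (lt_add_one _))
  have hC₃0 : 0 < C₃ := by positivity
  set M := 2 + C₂ + C₃
  have hM : 0 < M := by positivity
  set η := ε / M
  have hη : 0 < η := by positivity
  have hlim : Tendsto (fun p : E × G => (p.1, jacAdjoint h p.1 p.2)) (𝓝 (x, v))
      (𝓝 (x, jacAdjoint h x v)) :=
    (continuous_fst.tendsto _).prodMk_nhds
      (ContinuousAt.clm_apply (f := fun p : E × G => jacAdjoint h p.1) (g := Prod.snd)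
        (ContinuousAt.comp (f := Prod.fst) (g := jacAdjoint h) hcJ continuousAt_fst)
        continuousAt_snd)
  have hx : ∀ {P : E → Prop}, (∀ᶠ x' in 𝓝 x, P x') → ∀ᶠ p : E × G in 𝓝 (x, v), P p.1 :=
    fun hP => (continuous_fst.tendsto (x, v)).eventually hP
  filter_upwards [hlim.eventually (hN η hη), hx hΦ, hx hC₂', hx hC₃,
    hx (eventually_pairing_le hh u w v hη)] with p h1 h2 h3 h4 h5 hp
  have h6 := h1 (by rw [h2]; exact ⟨p.2, hp, rfl⟩)
  have h7 := (abs_le.1 (h5 p.2)).1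
  simp only [inner_neg_left] at h6
  have h8 : ‖jacAdjoint h p.1 p.2 - jacAdjoint h x v‖ ≤ C₃ * ‖p.2 - v‖ + C₂ * ‖p.1 - x‖ := by
    have : jacAdjoint h p.1 p.2 - jacAdjoint h x v
        = jacAdjoint h p.1 (p.2 - v) + (jacAdjoint h p.1 v - jacAdjoint h x v) := by
      rw [map_sub]; abel
    rw [this]
    exact (norm_add_le _ _).trans
      (add_le_add (ContinuousLinearMap.le_of_opNorm_le _ h4.le _) h3)
  have h9 : η * (‖p.1 - x‖ + ‖jacAdjoint h p.1 p.2 - jacAdjoint h x v‖) ≤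
      η * (‖p.1 - x‖ + (C₃ * ‖p.2 - v‖ + C₂ * ‖p.1 - x‖)) := by gcongr
  have h15 : ε * (‖p.1 - x‖ + ‖p.2 - v‖) = η * M * (‖p.1 - x‖ + ‖p.2 - v‖) := by
    rw [div_mul_cancel₀ _ hM.ne']
  have h16 : 0 ≤ η * (C₃ * ‖p.1 - x‖ + (1 + C₂) * ‖p.2 - v‖) := by positivity
  rw [h15]
  simp only [M]
  nlinarith

/-- Regular normals to the graph of the composition come from regular normals to the graph of `F`.
Moving `x` along the level set of the projection of `h` onto `L` shows that the first component,
corrected by the Hessian term, is orthogonal to the kernel of that projection's derivative, hence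
is `∇h(x)* q` for some `q ∈ L`. -/
lemma exists_regularNormal_of_regularNormal_comp [FiniteDimensional ℝ G]
    (hh : ContDiffAt ℝ 2 h x) {c : ℝ}
    (hc : ∀ s ∈ L, ‖s‖ ≤ c * ‖jacAdjoint h x s‖) (hv : v ∈ F (h x))
    (hF₂ : ∀ᶠ p : G × G in 𝓝 (h x, h x), p.2 - p.1 ∈ Lᗮ → F p.1 ⊆ F p.2)
    (hΦ : ∀ᶠ x' in 𝓝 x, Φ x' = jacAdjoint h x' '' F (h x'))
    (hN : WithLp.toLp 2 (w, -u) ∈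
      regularNormalCone (gph Φ) (WithLp.toLp 2 (x, jacAdjoint h x v))) :
    ∃ q ∈ L, w = fderiv ℝ (jacAdjoint h) x u v + jacAdjoint h x q ∧
      WithLp.toLp 2 (q, -fderiv ℝ h x u) ∈
        regularNormalCone (gph F) (WithLp.toLp 2 (h x, v)) := by
  obtain ⟨w, rfl⟩ : ∃ w', w = fderiv ℝ (jacAdjoint h) x u v + w' :=
    ⟨w - fderiv ℝ (jacAdjoint h) x u v, by abel⟩
  have hB := fun ε (hε : (0 : ℝ) < ε) => eventually_of_regularNormal_comp hh hΦ hN hε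
  have hdh : DifferentiableAt ℝ h x := hh.differentiableAt two_ne_zero
  set P := L.orthogonalProjectionOnto
  set A : E →L[ℝ] L := P.comp (fderiv ℝ h x)
  have hstrict : HasStrictFDerivAt (fun x' => P (h x')) A x :=
    P.hasStrictFDerivAt.comp x (hh.hasStrictFDerivAt two_ne_zero)
  have hsurj : A.range = ⊤ := by
    rw [LinearMap.range_eq_top]
    intro s
    obtain ⟨d, hd, -⟩ := exists_projection_apply_eq L (fderiv ℝ h x) hc s
    exact ⟨d, hd⟩
  obtain ⟨κ, hκ, hreg⟩ := exists_eventually_metricRegular hstrict hsurj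
  have hP : ∀ a b : G, P a = P b → a - b ∈ Lᗮ := fun a b hab => by
    rw [← Submodule.orthogonalProjectionOnto_eq_zero_iff, map_sub, sub_eq_zero]
    exact hab
  -- the corrected first component is orthogonal to the kernel of `A`
  have hker : ∀ d, A d = 0 → inner ℝ w d ≤ 0 := by
    intro d hd
    refine le_of_forall_pos_le_add fun ε hε => ?_
    set M := ‖d‖ + κ + ‖w‖ * κ + 1
    have hM : 0 < M := by positivity
    set η := min 1 (ε / M)
    have hη : 0 < η := by positivity
    have hη1 : η ≤ 1 := min_le_left _ _
    have hηM : η * M ≤ ε := by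
      have := mul_le_mul_of_nonneg_right (min_le_right 1 (ε / M)) hM.le
      rwa [div_mul_cancel₀ _ hM.ne'] at this
    have hlim : Tendsto (fun t : ℝ => x + t • d) (𝓝[>] 0) (𝓝 x) := by
      have : Continuous fun t : ℝ => x + t • d := by fun_prop
      simpa using (this.tendsto 0).mono_left nhdsWithin_le_nhds
    have h1 : ∀ᶠ t : ℝ in 𝓝[>] 0, ‖P (h x) - P (h (x + t • d))‖ ≤ η * (t * (‖d‖ / (‖d‖ + 1))) := by
      have := hstrict.hasFDerivAt.isLittleO.def (show 0 < η / (‖d‖ + 1) by positivity)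
      filter_upwards [hlim.eventually this, eventually_mem_nhdsWithin] with t ht ht0
      have ht0 : 0 < t := ht0
      simp only [add_sub_cancel_left, map_smul, hd, smul_zero, sub_zero, norm_smul,
        Real.norm_eq_abs, abs_of_pos ht0] at ht
      rw [norm_sub_rev]
      refine ht.trans (le_of_eq ?_)
      field_simp
    have h1 : ∀ᶠ t : ℝ in 𝓝[>] 0, ‖P (h x) - P (h (x + t • d))‖ ≤ η * t := by
      filter_upwards [h1, eventually_mem_nhdsWithin] with t ht ht0
      have ht0 : 0 < t := ht0
      refine ht.trans ?_
      have : ‖d‖ / (‖d‖ + 1) ≤ 1 := by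
        rw [div_le_one (by positivity)]; linarith
      have := mul_le_mul_of_nonneg_left this (show 0 ≤ η * t by positivity)
      linarith
    obtain ⟨γ, hγ⟩ := ((hlim.prodMk_nhds tendsto_const_nhds).eventually hreg).choice
    have hγd : ∀ᶠ t : ℝ in 𝓝[>] 0, ‖γ t - (x + t • d)‖ ≤ κ * (η * t) := by
      filter_upwards [hγ, h1] with t ht ht1
      exact ht.2.trans (mul_le_mul_of_nonneg_left ht1 hκ.le)
    have hγx : Tendsto γ (𝓝[>] 0) (𝓝 x) := by
      have hz : Tendsto (fun t : ℝ => κ * (η * t)) (𝓝[>] 0) (𝓝 0) := by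
        have : Continuous fun t : ℝ => κ * (η * t) := by fun_prop
        simpa using (this.tendsto 0).mono_left nhdsWithin_le_nhds
      have := (squeeze_zero_norm' hγd hz).add hlim
      simpa using this
    have hhγ : Tendsto (fun t => h (γ t)) (𝓝[>] 0) (𝓝 (h x)) := hdh.continuousAt.tendsto.comp hγx
    obtain ⟨t, ⟨ht1, -⟩, ht2, ht3, ht4, ht0⟩ := (hγ.and (hγd.and
      (((hγx.prodMk_nhds (tendsto_const_nhds (x := v))).eventually (hB η hη)).and
      (((tendsto_const_nhds.prodMk_nhds hhγ).eventually hF₂).and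
        eventually_mem_nhdsWithin)))).exists
    have ht0 : 0 < t := ht0
    have h5 := ht3 (ht4 (hP _ _ ht1) hv)
    simp only [sub_self, inner_zero_right, norm_zero, sub_zero, add_zero] at h5
    have h6 : ‖γ t - x‖ ≤ κ * (η * t) + t * ‖d‖ := by
      have : γ t - x = (γ t - (x + t • d)) + t • d := by abel
      rw [this]
      refine (norm_add_le _ _).trans (add_le_add ht2 ?_)
      rw [norm_smul, Real.norm_eq_abs, abs_of_pos ht0]
    have h7 : t * inner ℝ w d ≤ inner ℝ w (γ t - x) + ‖w‖ * (κ * (η * t)) := by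
      have e1 := (real_inner_le_norm w (-(γ t - (x + t • d)))).trans
        (mul_le_mul_of_nonneg_left ((norm_neg _).trans_le ht2) (norm_nonneg w))
      have e2 : -(γ t - (x + t • d)) = t • d - (γ t - x) := by abel
      rw [e2, inner_sub_right, inner_smul_right] at e1
      linarith
    have h8 : η * ‖γ t - x‖ ≤ η * (κ * (η * t) + t * ‖d‖) := by gcongr
    have h9 : t * inner ℝ w d ≤ t * (η * (κ * η + ‖d‖ + ‖w‖ * κ)) := by linarith
    have h10 := le_of_mul_le_mul_left h9 ht0
    have h11 : η * (κ * η + ‖d‖ + ‖w‖ * κ) ≤ η * M := by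
      refine mul_le_mul_of_nonneg_left ?_ hη.le
      have : κ * η ≤ κ * 1 := by gcongr
      simp only [M]
      linarith
    linarith
  have hperp : w ∈ A.kerᗮ := by
    rw [Submodule.mem_orthogonal']
    intro d hd
    have h1 := hker d hd
    have h2 := hker (-d) (by rw [map_neg, neg_eq_zero]; exact hd)
    rw [inner_neg_right] at h2
    linarith
  have hclosed : (ContinuousLinearMap.adjoint A).range.topologicalClosure
      = (ContinuousLinearMap.adjoint A).range :=
    (Submodule.closed_of_finiteDimensional _).submodule_topologicalClosure_eq
  rw [ContinuousLinearMap.orthogonal_ker, hclosed] at hperp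
  obtain ⟨q, hq⟩ := hperp
  have hq : jacAdjoint h x q = w := by
    rw [← hq]
    change _ = ContinuousLinearMap.adjoint (P.comp (fderiv ℝ h x)) q
    rw [ContinuousLinearMap.adjoint_comp, Submodule.adjoint_orthogonalProjectionOnto]
    rfl
  refine ⟨q, q.2, by rw [hq], ?_⟩
  rw [mem_regularNormalCone_gph_iff]
  refine ⟨hv, fun ε hε => ?_⟩
  set M := (1 + ‖(q : G)‖) * κ + 1
  have hM : 0 < M := by positivity
  set η := ε / M
  have hη : 0 < η := by positivity
  obtain ⟨ρ, hρ, hball⟩ := Metric.eventually_nhds_iff.1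
    ((hB η hη).and ((continuous_fst.tendsto (x, v)).eventually
      (hdh.hasFDerivAt.isLittleO.def hη)))
  obtain ⟨σ, hσ, hballσ⟩ := Metric.eventually_nhds_iff.1 hF₂
  obtain ⟨τ, hτ, hballτ⟩ := Metric.continuousAt_iff.1 hdh.continuousAt σ hσ
  have hlim : Tendsto (fun p : G × G => (x, P p.1)) (𝓝 (h x, v)) (𝓝 (x, P (h x))) :=
    tendsto_const_nhds.prodMk_nhds ((P.continuous.tendsto _).comp (continuous_fst.tendsto _))
  have hsmall : ∀ᶠ p : G × G in 𝓝 (h x, v), κ * ‖p.1 - h x‖ < min ρ τ ∧ ‖p.2 - v‖ < ρ ∧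
      ‖p.1 - h x‖ < σ := by
    have e1 : Continuous fun p : G × G => κ * ‖p.1 - h x‖ := by fun_prop
    have e2 : Continuous fun p : G × G => ‖p.2 - v‖ := by fun_prop
    have e3 : Continuous fun p : G × G => ‖p.1 - h x‖ := by fun_prop
    refine ((e1.tendsto (h x, v)).eventually (Iio_mem_nhds ?_)).and
      (((e2.tendsto (h x, v)).eventually (Iio_mem_nhds ?_)).and
      ((e3.tendsto (h x, v)).eventually (Iio_mem_nhds ?_)))
    · simpa using ⟨hρ, hτ⟩
    · simpa using hρ
    · simpa using hσ
  filter_upwards [hlim.eventually hreg, hsmall] with p ⟨x', hx', hxκ⟩ ⟨hs1, hs2, hs3⟩ hp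
  have hxκ : ‖x' - x‖ ≤ κ * ‖p.1 - h x‖ := by
    refine hxκ.trans (mul_le_mul_of_nonneg_left ?_ hκ.le)
    change ‖P p.1 - P (h x)‖ ≤ _
    rw [← map_sub]
    exact L.norm_orthogonalProjectionOnto_apply_le _
  have hx'P : P (h x') = P p.1 := hx'
  have hmem : p.2 ∈ F (h x') := by
    refine hballσ (y := (p.1, h x')) ?_ (hP _ _ hx'P) hp
    rw [Prod.dist_eq, max_lt_iff]
    refine ⟨by rw [dist_eq_norm]; exact hs3, hballτ ?_⟩
    rw [dist_eq_norm]
    exact hxκ.trans_lt (hs1.trans_le (min_le_right _ _))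
  obtain ⟨h1, h2⟩ := hball (y := (x', p.2)) (by
    rw [Prod.dist_eq, max_lt_iff, dist_eq_norm, dist_eq_norm]
    exact ⟨hxκ.trans_lt (hs1.trans_le (min_le_left _ _)), hs2⟩)
  have h3 := h1 hmem
  simp only at h2 h3
  have h4 : inner ℝ (q : G) (p.1 - h x) = inner ℝ (q : G) (h x' - h x) := by
    have := Submodule.inner_right_of_mem_orthogonal q.2 (hP _ _ hx'P)
    rw [show h x' - h x = (h x' - p.1) + (p.1 - h x) by abel, inner_add_right, this, zero_add]
  have h5 : inner ℝ (q : G) (h x' - h x) ≤ inner ℝ w (x' - x) + ‖(q : G)‖ * (η * ‖x' - x‖) := by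
    have e1 := (real_inner_le_norm (q : G) (h x' - h x - fderiv ℝ h x (x' - x))).trans
      (mul_le_mul_of_nonneg_left h2 (norm_nonneg _))
    rw [inner_sub_right, ← jacAdjoint_inner_left, hq] at e1
    linarith
  rw [h4, inner_neg_left]
  have h6 : η * (1 + ‖(q : G)‖) * ‖x' - x‖ ≤ η * (1 + ‖(q : G)‖) * (κ * ‖p.1 - h x‖) := by gcongr
  have h15 : ε * (‖p.1 - h x‖ + ‖p.2 - v‖) = η * M * (‖p.1 - h x‖ + ‖p.2 - v‖) := by
    rw [div_mul_cancel₀ _ hM.ne']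
  have h16 : 0 ≤ η * (‖p.1 - h x‖ + (1 + ‖(q : G)‖) * κ * ‖p.2 - v‖) := by positivity
  rw [h15]
  simp only [M]
  nlinarith

end RegularLevel

/-! ### The coderivative of `x ↦ ∇h(x)* F(h x)` -/

section CoderivativeComp

lemma tendsto_clm_apply {ι E F : Type*} [NormedAddCommGroup E] [NormedSpace ℝ E]
    [NormedAddCommGroup F] [NormedSpace ℝ F] {l : Filter ι} {A : ι → E →L[ℝ] F} {A₀ : E →L[ℝ] F}
    {x : ι → E} {x₀ : E} (hA : Tendsto A l (𝓝 A₀)) (hx : Tendsto x l (𝓝 x₀)) :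
    Tendsto (fun k => A k (x k)) l (𝓝 (A₀ x₀)) :=
  (isBoundedBilinearMap_apply.continuous.tendsto (A₀, x₀)).comp (hA.prodMk_nhds hx)

variable {E G : Type*} [NormedAddCommGroup E] [InnerProductSpace ℝ E] [CompleteSpace E]
  [NormedAddCommGroup G] [InnerProductSpace ℝ G] [CompleteSpace G] [FiniteDimensional ℝ G]
  {h : E → G} {x : E} {F : G → Set G} {Φ : E → Set E} {L : Submodule ℝ G} {v : G}

/-- Exact coderivative rule for `Φ = ∇h(·)* F(h ·)`, where near the reference point the values of
`F` lie in a translate of a subspace `L` meeting `ker ∇h(x)*` trivially and `F` is invariant along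
`Lᗮ`. The description of regular normals at nearby points passes to the limit because coercivity on
`L` makes the multipliers converge. -/
theorem coderivative_comp (hh : ContDiffAt ℝ 2 h x) (hv : v ∈ F (h x))
    (hL : ∀ s ∈ L, jacAdjoint h x s = 0 → s = 0)
    (hF₁ : ∀ᶠ z in 𝓝 (h x), ∀ v' ∈ F z, v' - v ∈ L)
    (hF₂ : ∀ᶠ p : G × G in 𝓝 (h x, h x), p.2 - p.1 ∈ Lᗮ → F p.1 ⊆ F p.2)
    (hΦ : ∀ᶠ x' in 𝓝 x, Φ x' = jacAdjoint h x' '' F (h x')) (u : E) :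
    coderivative Φ x (jacAdjoint h x v) u =
      (fun w => scalarizedHessian h v x u + jacAdjoint h x w) ''
        coderivative F (h x) v (fderiv ℝ h x u) := by
  have hch : ContinuousAt h x := hh.continuousAt
  have hcJ : Tendsto (jacAdjoint h) (𝓝 x) (𝓝 (jacAdjoint h x)) :=
    (contDiffAt_jacAdjoint hh).continuousAt
  have hcQ : Tendsto (fderiv ℝ (jacAdjoint h)) (𝓝 x) (𝓝 (fderiv ℝ (jacAdjoint h) x)) :=
    (contDiffAt_jacAdjoint hh).continuousAt_fderiv one_ne_zero
  have hcD : Tendsto (fderiv ℝ h) (𝓝 x) (𝓝 (fderiv ℝ h x)) :=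
    hh.continuousAt_fderiv two_ne_zero
  obtain ⟨c, hc0, hc⟩ := exists_eventually_norm_le L (jacAdjoint h x) hL
  have hc := hcJ.eventually hc
  have hh' : ∀ᶠ x' in 𝓝 x, ContDiffAt ℝ 2 h x' := hh.eventually (by simp)
  simp only [scalarizedHessian_apply hh]
  ext w
  constructor
  · intro hw
    obtain ⟨xs, ws, ys, us, hxs, hys, hws, hus, hN⟩ := exists_seq_of_mem_coderivative hw
    have hhxs : Tendsto (fun k => h (xs k)) atTop (𝓝 (h x)) := hch.tendsto.comp hxs
    obtain ⟨vs, hvs⟩ : ∃ vs : ℕ → G, ∀ᶠ k in atTop,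
        vs k ∈ F (h (xs k)) ∧ jacAdjoint h (xs k) (vs k) = ys k := by
      refine Eventually.choice (r := fun k v' => v' ∈ F (h (xs k)) ∧ jacAdjoint h (xs k) v' = ys k)
        ((hxs.eventually hΦ).mono fun k hk => ?_)
      have : ys k ∈ Φ (xs k) := (mem_regularNormalCone_gph_iff.1 (by simpa using hN k)).1
      rwa [hk] at this
    have hcxs := hxs.eventually hc
    have hvs_lim : Tendsto vs atTop (𝓝 v) := by
      rw [tendsto_iff_norm_sub_tendsto_zero]
      have h1 : Tendsto (fun k => c * ‖ys k - jacAdjoint h (xs k) v‖) atTop (𝓝 0) := by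
        have := (hys.sub (tendsto_clm_apply (hcJ.comp hxs)
          (tendsto_const_nhds (x := v)))).norm.const_mul c
        simpa using this
      refine squeeze_zero' (Eventually.of_forall fun k => norm_nonneg _) ?_ h1
      filter_upwards [hvs, hcxs, hhxs.eventually hF₁] with k h2 h3 h4
      have := h3 _ (h4 _ h2.1)
      rwa [map_sub, h2.2] at this
    obtain ⟨qs, hqs⟩ : ∃ qs : ℕ → G, ∀ᶠ k in atTop, qs k ∈ L ∧
        ws k = fderiv ℝ (jacAdjoint h) (xs k) (us k) (vs k) + jacAdjoint h (xs k) (qs k) ∧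
        WithLp.toLp 2 (qs k, -fderiv ℝ h (xs k) (us k)) ∈
          regularNormalCone (gph F) (WithLp.toLp 2 (h (xs k), vs k)) := by
      refine Eventually.choice (r := fun k q => q ∈ L ∧
        ws k = fderiv ℝ (jacAdjoint h) (xs k) (us k) (vs k) + jacAdjoint h (xs k) q ∧
        WithLp.toLp 2 (q, -fderiv ℝ h (xs k) (us k)) ∈
          regularNormalCone (gph F) (WithLp.toLp 2 (h (xs k), vs k))) ?_
      filter_upwards [hxs.eventually hh', hcxs, hvs, hxs.eventually hΦ.eventually_nhds,
        (hhxs.prodMk_nhds hhxs).eventually hF₂.eventually_nhds] with k h1 h2 h3 h4 h5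
      exact exists_regularNormal_of_regularNormal_comp h1 h2 h3.1 h5 h4 (by rw [h3.2]; exact hN k)
    -- the multipliers `qs` are bounded by coercivity, so a subsequence converges
    have hJq : Tendsto (fun k => ws k - fderiv ℝ (jacAdjoint h) (xs k) (us k) (vs k)) atTop
        (𝓝 (w - fderiv ℝ (jacAdjoint h) x u v)) :=
      hws.sub (tendsto_clm_apply (tendsto_clm_apply (hcQ.comp hxs) hus) hvs_lim)
    have hbdd : ∀ᶠ k in atTop, qs k ∈ Metric.closedBall (0 : G)
        (c * (‖w - fderiv ℝ (jacAdjoint h) x u v‖ + 1)) := by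
      filter_upwards [hqs, hcxs, hJq.norm.eventually (Iio_mem_nhds (lt_add_one _))] with k h1 h2 h3
      have h4 := h2 _ h1.1
      rw [h1.2.1, add_sub_cancel_left] at h3
      rw [mem_closedBall_zero_iff]
      exact h4.trans (mul_le_mul_of_nonneg_left (le_of_lt h3) hc0.le)
    obtain ⟨q, -, φ, hφ, hq⟩ :=
      tendsto_subseq_of_frequently_bounded Metric.isBounded_closedBall hbdd.frequently
    have hφ := hφ.tendsto_atTop
    refine ⟨q, mem_coderivative_of_tendsto hv (hhxs.comp hφ) (hvs_lim.comp hφ) hq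
      ((tendsto_clm_apply (hcD.comp hxs) hus).comp hφ)
      ((hφ.eventually hqs).mono fun k hk => hk.2.2), ?_⟩
    have h1 : Tendsto (fun k => ws (φ k)) atTop
        (𝓝 (fderiv ℝ (jacAdjoint h) x u v + jacAdjoint h x q)) := by
      have h2 := ((tendsto_clm_apply (tendsto_clm_apply (hcQ.comp hxs) hus) hvs_lim).comp hφ).add
        (tendsto_clm_apply ((hcJ.comp hxs).comp hφ) hq)
      refine h2.congr' ?_
      filter_upwards [hφ.eventually hqs] with k hk
      exact hk.2.1.symm
    exact tendsto_nhds_unique h1 (hws.comp hφ)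
  · rintro ⟨q, hq, rfl⟩
    obtain ⟨zs, qs, vs, ps, hzs, hvs, hqs, hps, hN⟩ := exists_seq_of_mem_coderivative hq
    set P := L.orthogonalProjectionOnto
    have hP : ∀ a b : G, P a = P b → a - b ∈ Lᗮ := fun a b hab => by
      rw [← Submodule.orthogonalProjectionOnto_eq_zero_iff, map_sub, sub_eq_zero]
      exact hab
    have hsurj : (P.comp (fderiv ℝ h x)).range = ⊤ := by
      rw [LinearMap.range_eq_top]
      intro s
      obtain ⟨d, hd, -⟩ := exists_projection_apply_eq L (fderiv ℝ h x) hc.self_of_nhds s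
      exact ⟨d, hd⟩
    have hstrict : HasStrictFDerivAt (fun x' => P (h x')) (P.comp (fderiv ℝ h x)) x :=
      P.hasStrictFDerivAt.comp x (hh.hasStrictFDerivAt two_ne_zero)
    obtain ⟨κ, hκ, hreg⟩ := exists_eventually_metricRegular hstrict hsurj
    have hPzs : Tendsto (fun k => P (zs k)) atTop (𝓝 (P (h x))) :=
      (P.continuous.tendsto _).comp hzs
    obtain ⟨xs, hxs'⟩ := (((tendsto_const_nhds (x := x)).prodMk_nhds hPzs).eventually hreg).choice
    have hxs : Tendsto xs atTop (𝓝 x) := by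
      rw [tendsto_iff_norm_sub_tendsto_zero]
      have h1 : Tendsto (fun k => κ * ‖P (zs k) - P (h x)‖) atTop (𝓝 0) := by
        simpa using (hPzs.sub_const (P (h x))).norm.const_mul κ
      exact squeeze_zero' (Eventually.of_forall fun k => norm_nonneg _)
        (hxs'.mono fun k hk => hk.2) h1
    have hhxs : Tendsto (fun k => h (xs k)) atTop (𝓝 (h x)) := hch.tendsto.comp hxs
    obtain ⟨ds, hds'⟩ : ∃ ds : ℕ → E, ∀ᶠ k in atTop,
        P (fderiv ℝ h (xs k) (ds k)) = P (ps k - fderiv ℝ h (xs k) u) ∧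
        ‖ds k‖ ≤ c * ‖P (ps k - fderiv ℝ h (xs k) u)‖ := by
      refine Eventually.choice
        (r := fun k d => P (fderiv ℝ h (xs k) d) = P (ps k - fderiv ℝ h (xs k) u) ∧
          ‖d‖ ≤ c * ‖P (ps k - fderiv ℝ h (xs k) u)‖)
        ((hxs.eventually hc).mono fun k hk => ?_)
      exact exists_projection_apply_eq L _ hk _
    have hds : Tendsto ds atTop (𝓝 0) := by
      have h1 : Tendsto (fun k => c * ‖P (ps k - fderiv ℝ h (xs k) u)‖) atTop (𝓝 0) := by
        have h2 : Tendsto (fun k => ps k - fderiv ℝ h (xs k) u) atTop (𝓝 0) := by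
          simpa using hps.sub (tendsto_clm_apply (hcD.comp hxs) (tendsto_const_nhds (x := u)))
        simpa using (((P.continuous.tendsto _).comp h2).norm.const_mul c)
      exact squeeze_zero_norm' (hds'.mono fun k hk => hk.2) h1
    have hus : Tendsto (fun k => u + ds k) atTop (𝓝 u) := by
      simpa using hds.const_add u
    refine mem_coderivative_of_tendsto
      (by rw [hΦ.self_of_nhds]; exact ⟨v, hv, rfl⟩) hxs
      (tendsto_clm_apply (hcJ.comp hxs) hvs)
      ((tendsto_clm_apply (tendsto_clm_apply (hcQ.comp hxs) hus) hvs).add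
        (tendsto_clm_apply (hcJ.comp hxs) hqs)) hus ?_
    filter_upwards [hxs', hds', hxs.eventually hh', hxs.eventually hc.eventually_nhds,
      hxs.eventually hΦ.eventually_nhds, hzs.eventually hF₁,
      hhxs.eventually hF₁.eventually_nhds,
      (hzs.prodMk_nhds hhxs).eventually hF₂.eventually_nhds,
      (hhxs.prodMk_nhds hzs).eventually hF₂.eventually_nhds] with k h1 h2 h3 h4 h5 h6 h7 h8 h9
    have hvk : vs k ∈ F (zs k) := (mem_regularNormalCone_gph_iff.1 (hN k)).1
    have hF₁k : ∀ᶠ z in 𝓝 (h (xs k)), ∀ v' ∈ F z, v' - vs k ∈ L := by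
      filter_upwards [h7] with z hz v' hv'
      have := L.sub_mem (hz v' hv') (h6 _ hvk)
      rwa [sub_sub_sub_cancel_right] at this
    refine regularNormal_comp_of_regularNormal h3 hc0 h4 hF₁k h5 ?_
    refine regularNormal_gph_translate hF₁k h8 h9 (hP _ _ h1.1) ?_ (hN k)
    rw [neg_sub_neg]
    refine hP _ _ ?_
    rw [map_add, map_add, h2.1, map_sub]
    abel

end CoderivativeComp

/-! ### The second-order subdifferential in the zero direction -/

section ZeroDirection

variable {G : Type*} [NormedAddCommGroup G] [InnerProductSpace ℝ G]

/-- A point of the relative interior of a finite-dimensional convex set, with a uniform radius in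
the directions parallel to the set. -/
lemma exists_relInterior_point [FiniteDimensional ℝ G] {D : Set G} (hD : Convex ℝ D)
    (hne : D.Nonempty) :
    ∃ r ∈ D, ∃ δ > 0, ∀ s ∈ (affineSpan ℝ D).direction, ‖s‖ < δ → r + s ∈ D := by
  obtain ⟨r, hr⟩ := hne.intrinsicInterior hD
  have hrD := intrinsicInterior_subset hr
  obtain ⟨⟨y, hy⟩, hyi, rfl⟩ := hr
  obtain ⟨δ, hδ, hball⟩ := Metric.mem_nhds_iff.1 (mem_interior_iff_mem_nhds.1 hyi)
  refine ⟨y, hrD, δ, hδ, fun s hs hsδ => ?_⟩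
  have hmem : y + s ∈ affineSpan ℝ D := by
    have := AffineSubspace.vadd_mem_of_mem_direction hs hy
    rwa [vadd_eq_add, add_comm] at this
  exact hball (a := ⟨y + s, hmem⟩) (by
    rw [Metric.mem_ball, Subtype.dist_eq, dist_eq_norm]
    simpa using hsδ)

/-- For a convex, radially affine function the second-order subdifferential in the zero direction is
the subspace parallel to the subdifferential. Every element of it is already a regular normal to the
graph at `(z, v')`, for each `v'` in the relative interior of `∂f(z)`, since near such a point the
graph only contains pairs whose first component differs from `z` by a vector orthogonal to the
subspace. -/
theorem coderivative_convexSubdiff_zero [FiniteDimensional ℝ G] [CompleteSpace G] {f : G → EReal}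
    {z v : G} {δ : ℝ} (hf : RadiallyAffine f z δ) (hδ : 0 < δ) (hc : ConvexFun f)
    (hl : LowerSemicontinuous f) (hv : v ∈ convexSubdiff f z) :
    coderivative (convexSubdiff f) z v 0 =
      ((affineSpan ℝ (convexSubdiff f z)).direction : Set G) := by
  set D := convexSubdiff f z
  set L := (affineSpan ℝ D).direction
  have hF₂ : ∀ᶠ p : G × G in 𝓝 (z, z), p.2 - p.1 ∈ Lᗮ →
      convexSubdiff f p.1 ⊆ convexSubdiff f p.2 := by
    rw [nhds_prod_eq]
    filter_upwards [(eventually_norm_sub_lt z (half_pos hδ)).prod_mk (eventually_norm_sub_lt z hδ)] with p hp hd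
    exact hf.convexSubdiff_subset_of_sub_mem hδ hc hl hp.1 hp.2 hd
  refine Set.Subset.antisymm (fun w hw => ?_) (fun s hs => ?_)
  · obtain ⟨zs, ws, vs, us, hzs, -, hws, -, hN⟩ := exists_seq_of_mem_coderivative hw
    have hclosed : IsClosed (L : Set G) := L.closed_of_finiteDimensional
    refine hclosed.mem_of_tendsto hws ?_
    filter_upwards [(hzs.prodMk_nhds hzs).eventually hF₂.eventually_nhds] with k hk
    exact mem_of_regularNormal_gph hk (hN k)
  · obtain ⟨r, hrD, ρ, hρ, hr⟩ := exists_relInterior_point (convex_convexSubdiff f z) ⟨v, hv⟩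
    have hmem : ∀ v₁ ∈ D, ∀ v₂ ∈ D, v₁ - v₂ ∈ L := fun v₁ h₁ v₂ h₂ =>
      AffineSubspace.vsub_mem_direction (subset_affineSpan ℝ _ h₁) (subset_affineSpan ℝ _ h₂)
    set t : ℕ → ℝ := fun k => 1 / ((k : ℝ) + 1)
    have ht : Tendsto t atTop (𝓝 0) := tendsto_one_div_add_atTop_nhds_zero_nat
    refine mem_coderivative_of_tendsto (ys := fun k => v + t k • (r - v)) hv
      (tendsto_const_nhds (x := z)) (by simpa using (ht.smul_const (r - v)).const_add v)
      (tendsto_const_nhds (x := s)) (tendsto_const_nhds (x := (0 : G)))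
      (Eventually.of_forall fun k => ?_)
    have ht0 : 0 < t k := by positivity
    have ht1 : t k ≤ 1 := by
      rw [div_le_one (by positivity)]
      linarith [k.cast_nonneg (α := ℝ)]
    set v' := v + t k • (r - v)
    have hv' : ∀ e ∈ L, ‖e‖ < t k * ρ → v' + e ∈ D := by
      intro e he hen
      have h1 := hr ((t k)⁻¹ • e) (L.smul_mem _ he) (by
        rw [norm_smul, Real.norm_eq_abs, abs_of_pos (inv_pos.2 ht0), inv_mul_lt_iff₀ ht0]
        exact hen)
      have h2 := convex_convexSubdiff f z hv h1 (a := 1 - t k) (b := t k) (by linarith) ht0.le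
        (by ring)
      have h3 : (1 - t k) • v + t k • (r + (t k)⁻¹ • e) = v' + e := by
        rw [smul_add, smul_smul, mul_inv_cancel₀ ht0.ne', one_smul]
        simp only [v']
        module
      rwa [h3] at h2
    have hv'D : v' ∈ D := by
      have := hv' 0 L.zero_mem (by rw [norm_zero]; positivity)
      rwa [add_zero] at this
    rw [mem_regularNormalCone_gph_iff]
    refine ⟨hv'D, fun ε hε => ?_⟩
    rw [nhds_prod_eq]
    have hv'near := eventually_norm_sub_lt v' (show 0 < t k * ρ / 2 by positivity)
    filter_upwards [(eventually_norm_sub_lt z (half_pos hδ)).prod_mk hv'near] with p hp hpF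
    have hpD : p.2 ∈ D := hf.convexSubdiff_subset hp.1 hpF
    -- monotonicity of the subdifferential at the two points of the graph
    have hmono : ∀ y ∈ D, 0 ≤ inner ℝ (p.2 - y) (p.1 - z) := by
      rintro y ⟨r₁, hr₁, h₁⟩
      obtain ⟨r₂, hr₂, h₂⟩ := hpF
      have e1 := h₁ p.1 r₂ hr₂.le
      have e2 := h₂ z r₁ hr₁.le
      rw [← neg_sub p.1 z, inner_neg_right] at e2
      rw [inner_sub_left]
      linarith
    -- `p.2 ± τ • s` belongs to `∂f(z)` for small `τ`
    have hs0 : inner ℝ s (p.1 - z) = 0 := by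
      set τ := t k * ρ / 2 / (‖s‖ + 1)
      have hτ : 0 < τ := by positivity
      have hτs : ‖τ • s‖ < t k * ρ / 2 := by
        rw [norm_smul, Real.norm_eq_abs, abs_of_pos hτ, div_mul_eq_mul_div,
          div_lt_iff₀ (by positivity)]
        exact mul_lt_mul_of_pos_left (lt_add_one _) (by positivity)
      have hL : τ • s ∈ L := L.smul_mem _ hs
      have h1 := hv' ((p.2 - v') + τ • s) (L.add_mem (hmem _ hpD _ hv'D) hL)
        ((norm_add_le _ _).trans_lt (by linarith [hp.2]))
      have h2 := hv' ((p.2 - v') - τ • s) (L.sub_mem (hmem _ hpD _ hv'D) hL)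
        ((norm_sub_le _ _).trans_lt (by linarith [hp.2]))
      have e1 := hmono _ h1
      have e2 := hmono _ h2
      rw [show p.2 - (v' + (p.2 - v' + τ • s)) = -(τ • s) by abel, inner_neg_left,
        real_inner_smul_left] at e1
      rw [show p.2 - (v' + (p.2 - v' - τ • s)) = τ • s by abel, real_inner_smul_left] at e2
      have : τ * inner ℝ s (p.1 - z) = 0 := by linarith
      exact (mul_eq_zero.1 this).resolve_left hτ.ne'
    rw [hs0, neg_zero, inner_zero_left, add_zero]
    positivity

end ZeroDirection

/-! ### The first-order chain rule -/

section FirstOrderChain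

lemma tendsto_of_norm_sub_lt {E : Type*} [NormedAddCommGroup E] {f g : ℕ → E} {g₀ : E}
    (hg : Tendsto g atTop (𝓝 g₀)) (hfg : ∀ᶠ k : ℕ in atTop, ‖f k - g k‖ < 1 / ((k : ℝ) + 1)) :
    Tendsto f atTop (𝓝 g₀) := by
  have := (squeeze_zero_norm' (hfg.mono fun k hk => le_of_lt hk)
    tendsto_one_div_add_atTop_nhds_zero_nat).add hg
  simpa using this

lemma mem_basicSubdiff_of_tendsto {E : Type*} [NormedAddCommGroup E] [InnerProductSpace ℝ E]
    {f : E → EReal} {x v : E} {r : ℝ} (hr : f x = r) {xs vs : ℕ → E} {rs : ℕ → ℝ}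
    (hxs : Tendsto xs atTop (𝓝 x)) (hrs : Tendsto rs atTop (𝓝 r)) (hvs : Tendsto vs atTop (𝓝 v))
    (h : ∀ᶠ k in atTop, f (xs k) = rs k ∧ vs k ∈ regularSubdiff f (xs k)) :
    v ∈ basicSubdiff f x := by
  obtain ⟨N, hN⟩ := eventually_atTop.1 h
  refine ⟨by simp [hr], by simp [hr], fun k => xs (k + N), fun k => vs (k + N),
    (tendsto_add_atTop_iff_nat N).2 hxs, ?_, fun k => (hN _ (by omega)).2,
    (tendsto_add_atTop_iff_nat N).2 hvs⟩
  have := (EReal.tendsto_coe.2 hrs).comp (tendsto_add_atTop_nat N)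
  rw [hr]
  refine this.congr fun k => ?_
  exact (hN (k + N) (by omega)).1.symm

lemma mem_singularSubdiff_of_tendsto {E : Type*} [NormedAddCommGroup E] [InnerProductSpace ℝ E]
    {f : E → EReal} {x v : E} {r : ℝ} (hr : f x = r) {xs vs : ℕ → E} {rs ts : ℕ → ℝ}
    (hxs : Tendsto xs atTop (𝓝 x)) (hrs : Tendsto rs atTop (𝓝 r)) (hts : Tendsto ts atTop (𝓝 0))
    (hvs : Tendsto (fun k => ts k • vs k) atTop (𝓝 v))
    (h : ∀ᶠ k in atTop, f (xs k) = rs k ∧ vs k ∈ regularSubdiff f (xs k) ∧ 0 < ts k) :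
    v ∈ singularSubdiff f x := by
  obtain ⟨N, hN⟩ := eventually_atTop.1 h
  refine ⟨by simp [hr], by simp [hr], fun k => xs (k + N), fun k => vs (k + N),
    fun k => ts (k + N), (tendsto_add_atTop_iff_nat N).2 hxs, ?_,
    fun k => (hN _ (by omega)).2.2, (tendsto_add_atTop_iff_nat N).2 hts,
    fun k => (hN _ (by omega)).2.1, (tendsto_add_atTop_iff_nat N (f := fun k => ts k • vs k)).2 hvs⟩
  have := (EReal.tendsto_coe.2 hrs).comp (tendsto_add_atTop_nat N)
  rw [hr]
  refine this.congr fun k => ?_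
  exact (hN (k + N) (by omega)).1.symm

variable {E G : Type*} [NormedAddCommGroup E] [InnerProductSpace ℝ E] [CompleteSpace E]
  [NormedAddCommGroup G] [InnerProductSpace ℝ G] [CompleteSpace G]
  {φ : E → EReal} {θ : G → EReal} {h : E → G} {x y : E}

/-- The elementary inclusion of the chain rule for a convex outer function. -/
lemma jacAdjoint_image_subset_basicSubdiff (hd : DifferentiableAt ℝ h x)
    (hφ : ∀ᶠ x' in 𝓝 x, φ x' = θ (h x')) :
    jacAdjoint h x '' convexSubdiff θ (h x) ⊆ basicSubdiff φ x := by
  rintro _ ⟨v, ⟨r, hr, hv⟩, rfl⟩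
  have hφx : φ x = r := hφ.self_of_nhds.trans hr
  refine regularSubdiff_subset_basicSubdiff φ x ⟨by simp [hφx], by simp [hφx], fun ε hε => ?_⟩
  filter_upwards [hφ, hd.hasFDerivAt.isLittleO.def (show 0 < ε / (‖v‖ + 1) by positivity)]
    with x' h1 h2
  rw [h1, hφx, EReal.toReal_coe]
  refine coe_le_of_forall_real fun s hs => ?_
  have h3 := hv _ s hs
  have h4 := (real_inner_le_norm v (-(h x' - h x - fderiv ℝ h x (x' - x)))).trans
    (mul_le_mul_of_nonneg_left ((norm_neg _).trans_le h2) (norm_nonneg v))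
  rw [inner_neg_right, inner_sub_right, ← jacAdjoint_inner_left] at h4
  have h5 : ‖v‖ * (ε / (‖v‖ + 1) * ‖x' - x‖) ≤ ε * ‖x' - x‖ := by
    rw [← mul_assoc]
    refine mul_le_mul_of_nonneg_right ?_ (norm_nonneg _)
    rw [mul_div_assoc', div_le_iff₀ (by positivity)]
    nlinarith [norm_nonneg v]
  linarith

/-- The gradient of the smooth part of the penalized problem vanishes at a local minimizer. -/
lemma jacAdjoint_eq_of_isLocalMin {x' : E} {z : G} {a k : ℝ} (hd : DifferentiableAt ℝ h x')
    (hmin : IsLocalMin (fun p => -inner ℝ y (p - x) + a * ‖p - x‖ ^ 2 + k / 2 * ‖h p - z‖ ^ 2) x') :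
    jacAdjoint h x' (k • (h x' - z)) = y - (2 * a) • (x' - x) := by
  have h1 : HasFDerivAt (fun p : E => p - x) (ContinuousLinearMap.id ℝ E) x' :=
    (hasFDerivAt_id x').sub_const x
  have h2 : HasFDerivAt (fun p : E => h p - z) (fderiv ℝ h x') x' := hd.hasFDerivAt.sub_const z
  have h3 := (((innerSL ℝ y).hasFDerivAt.comp x' h1).neg.add (h1.norm_sq.const_mul a)).add
    (h2.norm_sq.const_mul (k / 2))
  have h4 := hmin.hasFDerivAt_eq_zero (f' := _) h3
  refine ext_inner_right ℝ fun d => ?_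
  have h5 := DFunLike.congr_fun h4 d
  simp at h5
  simp only [jacAdjoint_inner_left, real_inner_smul_left, inner_sub_left]
  linarith

/-- Fuzzy chain rule: a regular subgradient of `θ ∘ h` is approximated by `∇h(x')* v'` with `v'` a
regular subgradient of `θ` at some `z'` near `h x`. The pair `(x', z')` minimizes
`θ z' - ⟪y, x' - x⟫ + a ‖x' - x‖² + (k / 2) ‖h x' - z'‖²` for large `k`, and
`v' = k • (h x' - z')`. -/
lemma exists_approx_of_mem_regularSubdiff [FiniteDimensional ℝ E] [FiniteDimensional ℝ G]
    (hl : LowerSemicontinuous θ) (hh : ContDiffAt ℝ 1 h x)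
    (hφ : ∀ᶠ x' in 𝓝 x, φ x' = θ (h x')) (hy : y ∈ regularSubdiff φ x) {r : ℝ} (hr : φ x = r)
    {ε : ℝ} (hε : 0 < ε) :
    ∃ (x' : E) (z' v' : G) (r' : ℝ), ‖x' - x‖ < ε ∧ ‖z' - h x‖ < ε ∧ θ z' = r' ∧ |r' - r| < ε ∧
      v' ∈ regularSubdiff θ z' ∧ ‖jacAdjoint h x' v' - y‖ < ε := by
  have hr' : θ (h x) = r := hφ.self_of_nhds.symm.trans hr
  -- radii
  obtain ⟨ρ, ⟨hρθ, hρε⟩, hρ⟩ : ∃ ρ : ℝ, ((∀ z ∈ Metric.closedBall (h x) ρ,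
      ((r - ε : ℝ) : EReal) < θ z) ∧ ρ < ε) ∧ 0 < ρ := by
    obtain ⟨ρ₀, hρ₀, hb⟩ := Metric.nhds_basis_closedBall.eventually_iff.1
      (hl (h x) ((r - ε : ℝ) : EReal) 
        (show _ < θ (h x) by rw [hr']; exact_mod_cast sub_lt_self r hε))
    refine ⟨min ρ₀ (ε / 2), ⟨fun z hz => hb ?_, ?_⟩, by positivity⟩
    · exact Metric.closedBall_subset_closedBall (min_le_left _ _) hz
    · exact (min_le_right _ _).trans_lt (half_lt_self hε)
  set ε₁ := ε / 8
  have hε₁ : 0 < ε₁ := by positivity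
  have hsub := hy.2.2 ε₁ hε₁
  rw [hr, EReal.toReal_coe] at hsub
  obtain ⟨R, ⟨hRball, hRε, hRy⟩, hR⟩ : ∃ R : ℝ, ((∀ x' ∈ Metric.closedBall x R,
      ContDiffAt ℝ 1 h x' ∧ ‖h x' - h x‖ < ρ / 2 ∧
      ((r + inner ℝ y (x' - x) - ε₁ * ‖x' - x‖ : ℝ) : EReal) ≤ θ (h x')) ∧ R < ε ∧
      ‖y‖ * R ≤ ε / 2) ∧ 0 < R := by
    have hev : ∀ᶠ x' in 𝓝 x, ContDiffAt ℝ 1 h x' ∧ ‖h x' - h x‖ < ρ / 2 ∧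
        ((r + inner ℝ y (x' - x) - ε₁ * ‖x' - x‖ : ℝ) : EReal) ≤ θ (h x') := by
      filter_upwards [hh.eventually (by simp), hh.continuousAt.eventually
        (eventually_norm_sub_lt (h x) (half_pos hρ)), hφ, hsub] with x' h1 h2 h3 h4
      exact ⟨h1, h2, by rw [← h3]; exact h4⟩
    obtain ⟨R₀, hR₀, hb⟩ := Metric.nhds_basis_closedBall.eventually_iff.1 hev
    refine ⟨min R₀ (ε / 2 / (‖y‖ + 1)), ⟨fun x' hx' => hb ?_, ?_, ?_⟩, by positivity⟩
    · exact Metric.closedBall_subset_closedBall (min_le_left _ _) hx'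
    · refine (min_le_right _ _).trans_lt ?_
      rw [div_lt_iff₀ (by positivity)]
      nlinarith [norm_nonneg y]
    · refine (mul_le_mul_of_nonneg_left (min_le_right _ _) (norm_nonneg y)).trans ?_
      rw [mul_div_assoc', div_le_iff₀ (by positivity)]
      nlinarith [norm_nonneg y]
  set a := 2 * ε₁ / R
  have ha : 0 < a := by positivity
  -- the compact truncated epigraph and the penalized objective
  set K : Set (E × G × ℝ) := {p | p.1 ∈ Metric.closedBall x R ∧ p.2.1 ∈ Metric.closedBall (h x) ρ ∧
    p.2.2 ∈ Set.Icc (r - ε) (r + ε) ∧ θ p.2.1 ≤ (p.2.2 : EReal)}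
  have hK : IsCompact K := by
    have h1 : IsClosed {p : E × G × ℝ | θ p.2.1 ≤ (p.2.2 : EReal)} :=
      hl.isClosed_epigraph.preimage (f := fun p : E × G × ℝ => (p.2.1, (p.2.2 : EReal)))
        ((continuous_fst.comp continuous_snd).prodMk
          (continuous_coe_real_ereal.comp (continuous_snd.comp continuous_snd)))
    have h2 : IsCompact (Metric.closedBall x R ×ˢ (Metric.closedBall (h x) ρ ×ˢ
        Set.Icc (r - ε) (r + ε))) :=
      (isCompact_closedBall _ _).prod ((isCompact_closedBall _ _).prod isCompact_Icc)
    have h3 : K = (Metric.closedBall x R ×ˢ (Metric.closedBall (h x) ρ ×ˢ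
        Set.Icc (r - ε) (r + ε))) ∩ {p : E × G × ℝ | θ p.2.1 ≤ (p.2.2 : EReal)} := by
      ext p
      simp only [K, Set.mem_ofPred_eq, Set.mem_inter_iff, Set.mem_prod]
      tauto
    rw [h3]
    exact h2.inter_right h1
  have hx0K : (x, h x, r) ∈ K :=
    ⟨Metric.mem_closedBall_self hR.le, Metric.mem_closedBall_self hρ.le,
      ⟨by linarith, by linarith⟩, hr'.le⟩
  set g : ℕ → E × G × ℝ → ℝ := fun k p =>
    p.2.2 + (-inner ℝ y (p.1 - x) + a * ‖p.1 - x‖ ^ 2 + (k : ℝ) / 2 * ‖h p.1 - p.2.1‖ ^ 2)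
  have hhc : ContinuousOn h (Metric.closedBall x R) := fun x' hx' =>
    (hRball x' hx').1.continuousAt.continuousWithinAt
  have hhK : ContinuousOn (fun p : E × G × ℝ => h p.1) K :=
    hhc.comp continuousOn_fst fun p hp => hp.1
  have hg : ∀ k, ContinuousOn (g k) K := by
    intro k
    have h1 : ContinuousOn (fun p : E × G × ℝ => (k : ℝ) / 2 * ‖h p.1 - p.2.1‖ ^ 2) K :=
      continuousOn_const.mul ((hhK.sub (by fun_prop)).norm.pow 2)
    have h2 : ContinuousOn
        (fun p : E × G × ℝ => -inner ℝ y (p.1 - x) + a * ‖p.1 - x‖ ^ 2) K := by fun_prop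
    have h3 : ContinuousOn (fun p : E × G × ℝ => p.2.2) K := by fun_prop
    exact h3.add (h2.add h1)
  choose p hpK hpmin using fun k => hK.exists_isMinOn ⟨_, hx0K⟩ (hg k)
  have hple : ∀ k, g k (p k) ≤ r := by
    intro k
    have := hpmin k hx0K
    simpa [g] using this
  have hinner : ∀ k, inner ℝ y ((p k).1 - x) ≤ ε / 2 := by
    intro k
    refine (real_inner_le_norm _ _).trans (le_trans ?_ hRy)
    exact mul_le_mul_of_nonneg_left (by simpa [dist_eq_norm] using (hpK k).1) (norm_nonneg y)
  -- the penalty term tends to zero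
  have hpen : ∀ k : ℕ, (k : ℝ) * ‖h (p k).1 - (p k).2.1‖ ^ 2 ≤ 3 * ε := by
    intro k
    have h1 := hple k
    have h2 := (hpK k).2.2.1.1
    have h3 := hinner k
    have h4 : 0 ≤ a * ‖(p k).1 - x‖ ^ 2 := by positivity
    simp only [g] at h1
    linarith
  have hpen0 : Tendsto (fun k => h (p k).1 - (p k).2.1) atTop (𝓝 0) := by
    rw [tendsto_zero_iff_norm_tendsto_zero]
    have h1 : Tendsto (fun k : ℕ => 3 * ε / k) atTop (𝓝 0) :=
      tendsto_const_div_atTop_nhds_zero_nat _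
    have h2 : Tendsto (fun k => ‖h (p k).1 - (p k).2.1‖ ^ 2) atTop (𝓝 0) := by
      refine squeeze_zero' (Eventually.of_forall fun k => by positivity) ?_ h1
      filter_upwards [eventually_gt_atTop 0] with k hk
      rw [le_div_iff₀ (by exact_mod_cast hk), mul_comm]
      exact hpen k
    have h3 := (Real.continuous_sqrt.tendsto 0).comp h2
    simpa [Function.comp_def, Real.sqrt_sq] using h3
  -- at cluster points the first component stays within half the radius
  obtain ⟨pl, hplK, ψ, hψ, hlim⟩ := hK.tendsto_subseq hpK
  have hψt := hψ.tendsto_atTop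
  have hl1 : Tendsto (fun k => (p (ψ k)).1) atTop (𝓝 pl.1) := (continuous_fst.tendsto _).comp hlim
  have hl2 : Tendsto (fun k => (p (ψ k)).2.1) atTop (𝓝 pl.2.1) :=
    ((continuous_fst.comp continuous_snd).tendsto _).comp hlim
  have hl3 : Tendsto (fun k => (p (ψ k)).2.2) atTop (𝓝 pl.2.2) :=
    ((continuous_snd.comp continuous_snd).tendsto _).comp hlim
  have hpl : h pl.1 = pl.2.1 := by
    have h1 : Tendsto (fun k => h (p (ψ k)).1) atTop (𝓝 (h pl.1)) :=
      (hRball _ hplK.1).1.continuousAt.tendsto.comp hl1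
    have h2 := tendsto_nhds_unique (h1.sub hl2) (hpen0.comp hψt)
    exact sub_eq_zero.1 h2
  have hplR : ‖pl.1 - x‖ < R := by
    have h1 : pl.2.2 + (-inner ℝ y (pl.1 - x) + a * ‖pl.1 - x‖ ^ 2) ≤ r := by
      have h2 : Tendsto (fun k => (p (ψ k)).2.2 + (-inner ℝ y ((p (ψ k)).1 - x) +
          a * ‖(p (ψ k)).1 - x‖ ^ 2)) atTop
          (𝓝 (pl.2.2 + (-inner ℝ y (pl.1 - x) + a * ‖pl.1 - x‖ ^ 2))) := by
        have h3 := hl1.sub_const x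
        exact hl3.add (((tendsto_const_nhds.inner h3).neg).add ((h3.norm.pow 2).const_mul a))
      refine le_of_tendsto h2 (Eventually.of_forall fun k => ?_)
      have h4 := hple (ψ k)
      have h5 : 0 ≤ ((ψ k : ℕ) : ℝ) / 2 * ‖h (p (ψ k)).1 - (p (ψ k)).2.1‖ ^ 2 := by positivity
      simp only [g] at h4
      linarith
    have h2 := (hRball _ hplK.1).2.2.trans (hpl ▸ hplK.2.2.2)
    rw [EReal.coe_le_coe_iff] at h2
    by_contra! hge
    have h3 : a * ‖pl.1 - x‖ ^ 2 ≤ ε₁ * ‖pl.1 - x‖ := by linarith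
    have h4 : 0 < ‖pl.1 - x‖ := hR.trans_le hge
    have h5 : a * ‖pl.1 - x‖ ≤ ε₁ := by
      refine le_of_mul_le_mul_right ?_ h4
      linarith
    have h6 : a * R ≤ a * ‖pl.1 - x‖ := by gcongr
    have h7 : a * R = 2 * ε₁ := div_mul_cancel₀ _ hR.ne'
    linarith
  obtain ⟨k, hkR, hkρ⟩ : ∃ k, ‖(p k).1 - x‖ < R ∧ ‖h (p k).1 - (p k).2.1‖ < ρ / 2 := by
    obtain ⟨j, h1, h2⟩ := (((hl1.sub_const x).norm.eventually (Iio_mem_nhds hplR)).and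
      ((hpen0.comp hψt).norm.eventually (Iio_mem_nhds (show ‖(0 : G)‖ < ρ / 2 by simpa using hρ)))).exists
    exact ⟨ψ j, h1, h2⟩
  have hmin := hpmin k
  have hle := hple k
  have hin := hinner k
  have hpk := hpK k
  generalize p k = q at hkR hkρ hmin hle hin hpk
  obtain ⟨x', z', r'⟩ := q
  simp only at hkR hkρ hin
  have hz' : ‖z' - h x‖ < ρ := by
    have h1 := (hRball x' hpk.1).2.1
    have : z' - h x = (h x' - h x) - (h x' - z') := by abel
    rw [this]
    linarith [norm_sub_le (h x' - h x) (h x' - z')]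
  have hr'lt : r' ≤ r + ε / 2 := by
    simp only [g] at hle
    have h4 : 0 ≤ a * ‖x' - x‖ ^ 2 := by positivity
    have h5 : 0 ≤ (k : ℝ) / 2 * ‖h x' - z'‖ ^ 2 := by positivity
    linarith
  have hθlt : ((r - ε : ℝ) : EReal) < θ z' := hρθ z' hpk.2.1
  have hθle : θ z' ≤ (r' : EReal) := hpk.2.2.2
  have hθ : θ z' = r' := by
    obtain ⟨s, hs⟩ : ∃ s : ℝ, θ z' = s :=
      ⟨_, (EReal.coe_toReal (hθle.trans_lt (EReal.coe_lt_top _)).ne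
        (bot_le.trans_lt hθlt).ne').symm⟩
    rw [hs, EReal.coe_lt_coe_iff] at hθlt
    rw [hs, EReal.coe_le_coe_iff] at hθle
    have := hmin (show (x', z', s) ∈ K from
      ⟨hpk.1, hpk.2.1, ⟨hθlt.le, by linarith⟩, hs.le⟩)
    simp only [g, Set.mem_ofPred_eq, add_le_add_iff_right] at this
    rw [hs, le_antisymm hθle this]
  rw [hθ, EReal.coe_lt_coe_iff] at hθlt
  refine ⟨x', z', (k : ℝ) • (h x' - z'), r', hkR.trans hRε, hz'.trans hρε, hθ, ?_, ?_, ?_⟩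
  · rw [abs_lt]
    constructor <;> linarith
  · refine ⟨by simp [hθ], by simp [hθ], fun η hη => ?_⟩
    rw [hθ, EReal.toReal_coe]
    have hc1 : ∀ᶠ z in 𝓝 z', ‖z - h x‖ < ρ := by
      have : Continuous fun z : G => ‖z - h x‖ := by fun_prop
      exact (this.tendsto z').eventually (Iio_mem_nhds hz')
    have hc2 : ∀ᶠ z in 𝓝 z', (k : ℝ) / 2 * ‖z - z'‖ < η := by
      have : Continuous fun z : G => (k : ℝ) / 2 * ‖z - z'‖ := by fun_prop
      exact (this.tendsto z').eventually (Iio_mem_nhds (by simpa using hη))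
    have hc3 : ∀ᶠ z in 𝓝 z', r' + inner ℝ ((k : ℝ) • (h x' - z')) (z - z') < r + ε := by
      have : Continuous fun z : G => r' + inner ℝ ((k : ℝ) • (h x' - z')) (z - z') := by fun_prop
      exact (this.tendsto z').eventually (Iio_mem_nhds (by
        simp only [sub_self, inner_zero_right, add_zero]
        linarith))
    filter_upwards [hc1, hc2, hc3] with z h1 h2 h3
    refine coe_le_of_forall_real fun s hs => ?_
    have hn := norm_nonneg (z - z')
    rcases le_or_gt s (r + ε) with hsr | hsr
    · have hzb : z ∈ Metric.closedBall (h x) ρ := by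
        rw [Metric.mem_closedBall, dist_eq_norm]; exact h1.le
      have h4 := (hρθ z hzb).trans_le hs
      rw [EReal.coe_lt_coe_iff] at h4
      have h5 := hmin (show (x', z, s) ∈ K from ⟨hpk.1, hzb, ⟨h4.le, hsr⟩, hs⟩)
      simp only [g, Set.mem_ofPred_eq] at h5
      have h6 : ‖h x' - z‖ ^ 2
          = ‖h x' - z'‖ ^ 2 - 2 * inner ℝ (h x' - z') (z - z') + ‖z - z'‖ ^ 2 := by
        rw [← norm_sub_sq_real]
        congr 2
        abel
      rw [h6] at h5
      rw [real_inner_smul_left]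
      nlinarith
    · nlinarith
  · have hloc : IsLocalMin
        (fun p => -inner ℝ y (p - x) + a * ‖p - x‖ ^ 2 + (k : ℝ) / 2 * ‖h p - z'‖ ^ 2) x' := by
      have : Continuous fun p : E => ‖p - x‖ := by fun_prop
      filter_upwards [(this.tendsto x').eventually (Iio_mem_nhds hkR)] with p' hp'
      have h5 := hmin (show (p', z', r') ∈ K from
        ⟨by rw [Metric.mem_closedBall, dist_eq_norm]; exact le_of_lt hp', hpk.2⟩)
      simp only [g, Set.mem_ofPred_eq] at h5
      linarith
    rw [jacAdjoint_eq_of_isLocalMin ((hRball x' hpk.1).1.differentiableAt one_ne_zero) hloc,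
      sub_sub_cancel_left, norm_neg, norm_smul, Real.norm_eq_abs, abs_of_pos (by positivity)]
    have h6 : 2 * a * ‖x' - x‖ ≤ 2 * a * R := by gcongr
    have h7 : a * R = 2 * ε₁ := div_mul_cancel₀ _ hR.ne'
    have h8 : ε₁ = ε / 8 := rfl
    linarith

/-- The limiting chain rule `∂(θ ∘ h)(x) ⊆ ∇h(x)* ∂θ(h x)` under the first-order qualification
condition. The condition keeps the approximate multipliers of the fuzzy rule bounded: otherwise
their directions would accumulate at a unit singular subgradient in `ker ∇h(x)*`. -/
theorem basicSubdiff_subset_jacAdjoint_image [FiniteDimensional ℝ E] [FiniteDimensional ℝ G]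
    (hl : LowerSemicontinuous θ) (hh : ContDiffAt ℝ 1 h x)
    (hφ : ∀ᶠ x' in 𝓝 x, φ x' = θ (h x'))
    (hqc : ∀ w ∈ singularSubdiff θ (h x), jacAdjoint h x w = 0 → w = 0) :
    basicSubdiff φ x ⊆ jacAdjoint h x '' basicSubdiff θ (h x) := by
  rintro y ⟨hxt, hxb, xs, ys, hxs, hφxs, hreg, hys⟩
  obtain ⟨r, hr⟩ : ∃ r : ℝ, φ x = r := ⟨_, (EReal.coe_toReal hxt hxb).symm⟩
  have hrθ : θ (h x) = r := hφ.self_of_nhds.symm.trans hr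
  choose rs hrs using fun k => (⟨_, (EReal.coe_toReal (hreg k).1 (hreg k).2.1).symm⟩ :
    ∃ r : ℝ, φ (xs k) = r)
  have hrs_lim : Tendsto rs atTop (𝓝 r) := by
    simp only [hrs, hr] at hφxs
    exact EReal.tendsto_coe.1 hφxs
  obtain ⟨d, hd⟩ := Eventually.choice (r := fun (k : ℕ) (d : E × G × G × ℝ) =>
      ‖d.1 - xs k‖ < 1 / ((k : ℝ) + 1) ∧ ‖d.2.1 - h (xs k)‖ < 1 / ((k : ℝ) + 1) ∧
      θ d.2.1 = d.2.2.2 ∧ |d.2.2.2 - rs k| < 1 / ((k : ℝ) + 1) ∧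
      d.2.2.1 ∈ regularSubdiff θ d.2.1 ∧
      ‖jacAdjoint h d.1 d.2.2.1 - ys k‖ < 1 / ((k : ℝ) + 1)) (l := atTop) (by
    filter_upwards [hxs.eventually hφ.eventually_nhds,
      hxs.eventually (hh.eventually (by simp))] with k h1 h2
    obtain ⟨x', z', v', r', h3⟩ := exists_approx_of_mem_regularSubdiff hl h2 h1 (hreg k) (hrs k)
      (show 0 < 1 / ((k : ℝ) + 1) by positivity)
    exact ⟨(x', z', v', r'), h3⟩)
  have hx' : Tendsto (fun k => (d k).1) atTop (𝓝 x) :=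
    tendsto_of_norm_sub_lt hxs (hd.mono fun k hk => hk.1)
  have hz' : Tendsto (fun k => (d k).2.1) atTop (𝓝 (h x)) :=
    tendsto_of_norm_sub_lt (hh.continuousAt.tendsto.comp hxs) (hd.mono fun k hk => hk.2.1)
  have hr' : Tendsto (fun k => (d k).2.2.2) atTop (𝓝 r) :=
    tendsto_of_norm_sub_lt hrs_lim (hd.mono fun k hk => hk.2.2.2.1)
  have hJv : Tendsto (fun k => jacAdjoint h (d k).1 (d k).2.2.1) atTop (𝓝 y) :=
    tendsto_of_norm_sub_lt hys (hd.mono fun k hk => hk.2.2.2.2.2)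
  have hJ : Tendsto (fun k => jacAdjoint h (d k).1) atTop (𝓝 (jacAdjoint h x)) :=
    (continuousAt_jacAdjoint hh).tendsto.comp hx'
  by_cases hbdd : ∃ B : ℝ, ∃ᶠ k in atTop, ‖(d k).2.2.1‖ ≤ B
  · obtain ⟨B, hB⟩ := hbdd
    obtain ⟨v, -, ψ, hψ, hv⟩ := tendsto_subseq_of_frequently_bounded
      (Metric.isBounded_closedBall (x := (0 : G)) (r := B)) (x := fun k => (d k).2.2.1)
      (hB.mono fun k hk => by simpa using hk)
    have hψt := hψ.tendsto_atTop
    refine ⟨v, mem_basicSubdiff_of_tendsto hrθ (hz'.comp hψt) (hr'.comp hψt) hv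
      ((hψt.eventually hd).mono fun k hk => ⟨hk.2.2.1, hk.2.2.2.2.1⟩), ?_⟩
    exact tendsto_nhds_unique (tendsto_clm_apply (hJ.comp hψt) hv) (hJv.comp hψt)
  · exfalso
    push Not at hbdd
    have hinf : Tendsto (fun k => ‖(d k).2.2.1‖) atTop atTop :=
      tendsto_atTop.2 fun B => (hbdd B).mono fun k hk => le_of_lt hk
    have hts : Tendsto (fun k => ‖(d k).2.2.1‖⁻¹) atTop (𝓝 0) := tendsto_inv_atTop_zero.comp hinf
    have hsph : ∀ᶠ k in atTop, ‖(d k).2.2.1‖⁻¹ • (d k).2.2.1 ∈ Metric.sphere (0 : G) 1 := by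
      filter_upwards [hinf.eventually_gt_atTop 0] with k hk
      rw [mem_sphere_zero_iff_norm, norm_smul, norm_inv, norm_norm, inv_mul_cancel₀ hk.ne']
    obtain ⟨w, hw1, ψ, hψ, hw⟩ := tendsto_subseq_of_frequently_bounded
      (Metric.isBounded_sphere (x := (0 : G)) (r := 1)) hsph.frequently
    have hψt := hψ.tendsto_atTop
    rw [Metric.isClosed_sphere.closure_eq, mem_sphere_zero_iff_norm] at hw1
    have hwS : w ∈ singularSubdiff θ (h x) := by
      refine mem_singularSubdiff_of_tendsto hrθ (hz'.comp hψt) (hr'.comp hψt) (hts.comp hψt) hw ?_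
      filter_upwards [hψt.eventually hd, hψt.eventually (hinf.eventually_gt_atTop 0)] with k h1 h2
      exact ⟨h1.2.2.1, h1.2.2.2.2.1, inv_pos.2 h2⟩
    have hJw : jacAdjoint h x w = 0 := by
      refine tendsto_nhds_unique (tendsto_clm_apply (hJ.comp hψt) hw) ?_
      have := (hts.smul hJv).comp hψt
      rw [zero_smul] at this
      refine this.congr fun k => ?_
      simp
    rw [hqc w hwS hJw, norm_zero] at hw1
    exact zero_ne_one hw1

end FirstOrderChain

/-! ### The second-order qualification condition -/

section Qualification

/-- Near `z` all subgradients belong to `∂f(z)`, so rescaled limits of them are parallel to it. -/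
lemma RadiallyAffine.singularSubdiff_subset {G : Type*} [NormedAddCommGroup G]
    [InnerProductSpace ℝ G] [FiniteDimensional ℝ G] {f : G → EReal} {z z' v₀ : G} {δ : ℝ}
    (hf : RadiallyAffine f z δ) (hc : ConvexFun f) (hv₀ : v₀ ∈ convexSubdiff f z)
    (hz' : ‖z' - z‖ < δ / 2) :
    singularSubdiff f z' ⊆ (affineSpan ℝ (convexSubdiff f z)).direction := by
  rintro w ⟨-, -, xs, vs, ts, hxs, -, -, hts, hvs, hlim⟩
  set L := (affineSpan ℝ (convexSubdiff f z)).direction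
  have hclosed : IsClosed (L : Set G) := L.closed_of_finiteDimensional
  have h1 : Tendsto (fun k => ts k • (vs k - v₀)) atTop (𝓝 w) := by
    have := hlim.sub (hts.smul_const v₀)
    simpa [smul_sub] using this
  refine hclosed.mem_of_tendsto h1 ?_
  filter_upwards [(hxs.sub_const z).norm.eventually (Iio_mem_nhds hz')] with k hk
  refine L.smul_mem _ (AffineSubspace.vsub_mem_direction (subset_affineSpan ℝ _ ?_)
    (subset_affineSpan ℝ _ hv₀))
  exact hf.convexSubdiff_subset hk (hc.regularSubdiff_subset _ (hvs k))

variable {E G : Type*} [NormedAddCommGroup E] [InnerProductSpace ℝ E] [CompleteSpace E]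
  [NormedAddCommGroup G] [InnerProductSpace ℝ G] [CompleteSpace G]

lemma coe_inter_ker_eq_zero_iff (S : Submodule ℝ G) (h : E → G) (x : E) :
    (S : Set G) ∩ {w | jacAdjoint h x w = 0} = {0} ↔ ∀ s ∈ S, jacAdjoint h x s = 0 → s = 0 := by
  refine ⟨fun hS s hs h0 => ?_, fun hS => Set.Subset.antisymm (fun s hs => hS s hs.1 hs.2) ?_⟩
  · have : s ∈ (S : Set G) ∩ {w | jacAdjoint h x w = 0} := ⟨hs, h0⟩
    rwa [hS] at this
  · rintro _ rfl
    exact ⟨S.zero_mem, map_zero _⟩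

/-- Trivial intersection of `S` with `ker ∇h(x)*` is surjectivity of the projected derivative. -/
lemma finrank_range_projection_comp_eq_iff [FiniteDimensional ℝ G] (S : Submodule ℝ G) (h : E → G)
    (x : E) :
    Module.finrank ℝ (S.orthogonalProjectionOnto ∘L fderiv ℝ h x).range = Module.finrank ℝ S ↔
      ∀ s ∈ S, jacAdjoint h x s = 0 → s = 0 := by
  constructor
  · intro hrank s hs h0
    have htop := Submodule.eq_top_of_finrank_eq hrank
    obtain ⟨d, hd⟩ := LinearMap.range_eq_top.1 htop ⟨s, hs⟩
    have hd : S.orthogonalProjectionOnto (fderiv ℝ h x d) = ⟨s, hs⟩ := hd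
    have h1 : inner ℝ (S.orthogonalProjectionOnto (fderiv ℝ h x d) : G) s
        = inner ℝ (fderiv ℝ h x d) s :=
      Submodule.inner_orthogonalProjectionOnto_eq_of_mem_right ⟨s, hs⟩ _
    rw [← jacAdjoint_inner_right, h0, inner_zero_right, hd] at h1
    exact inner_self_eq_zero.1 h1
  · intro hS
    obtain ⟨c, -, hc⟩ := exists_eventually_norm_le S (jacAdjoint h x) hS
    have htop : (S.orthogonalProjectionOnto ∘L fderiv ℝ h x).range = ⊤ := by
      rw [LinearMap.range_eq_top]
      intro s
      obtain ⟨d, hd, -⟩ := exists_projection_apply_eq S (fderiv ℝ h x) hc.self_of_nhds s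
      exact ⟨d, hd⟩
    rw [htop, finrank_top]

end Qualification

/-! ### The second-order chain rule -/

section Main

variable {E G : Type*} [NormedAddCommGroup E] [InnerProductSpace ℝ E] [CompleteSpace E]
  [FiniteDimensional ℝ E] [NormedAddCommGroup G] [InnerProductSpace ℝ G] [CompleteSpace G]
  [FiniteDimensional ℝ G] {φ : E → EReal} {θ : G → EReal} {h : E → G} {x : E}

/-- Under the second-order qualification condition the first-order chain rule holds with equality at
all points near `x`. -/
lemma eventually_basicSubdiff_eq {δ : ℝ} {v₀ : G} (hf : RadiallyAffine θ (h x) δ) (hδ : 0 < δ)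
    (hc : ConvexFun θ) (hl : LowerSemicontinuous θ) (hv₀ : v₀ ∈ convexSubdiff θ (h x))
    (hh : ContDiffAt ℝ 2 h x) (hφ : ∀ᶠ x' in 𝓝 x, φ x' = θ (h x'))
    (hS : ∀ s ∈ (affineSpan ℝ (convexSubdiff θ (h x))).direction, jacAdjoint h x s = 0 → s = 0) :
    ∀ᶠ x' in 𝓝 x, basicSubdiff φ x' = jacAdjoint h x' '' convexSubdiff θ (h x') := by
  obtain ⟨c, -, hcoer⟩ := exists_eventually_norm_le _ (jacAdjoint h x) hS
  filter_upwards [(contDiffAt_jacAdjoint hh).continuousAt.eventually hcoer,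
    hφ.eventually_nhds, hh.eventually (by simp),
    hh.continuousAt.eventually (eventually_norm_sub_lt (h x) (half_pos hδ))] with x' h1 h2 h3 h4
  refine Set.Subset.antisymm ?_
    (jacAdjoint_image_subset_basicSubdiff (h3.differentiableAt two_ne_zero) h2)
  rw [← hc.basicSubdiff_eq]
  refine basicSubdiff_subset_jacAdjoint_image hl (h3.of_le (by norm_num)) h2 fun w hw hw0 => ?_
  have h5 := h1 w (hf.singularSubdiff_subset hc hv₀ h4 hw)
  rw [hw0, norm_zero, mul_zero] at h5
  exact norm_le_zero_iff.1 h5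

end Main

end VarAnalysis

theorem theorem4p3 {n m : ℕ}
    (φ : EuclideanSpace ℝ (Fin n) → EReal) (θ : EuclideanSpace ℝ (Fin m) → EReal)
    (h : EuclideanSpace ℝ (Fin n) → EuclideanSpace ℝ (Fin m))
    (xbar ybar : EuclideanSpace ℝ (Fin n))
    (hamen : FullyAmenableComp φ θ h xbar)
    (hpl : PiecewiseLinear θ)
    (hy : ybar ∈ basicSubdiff φ xbar) :
    -- under the qualification condition, the exact chain rule with a unique multiplier
    (SecondOrderQC θ h xbar ybar →
      ∃ vbar : EuclideanSpace ℝ (Fin m),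
        (vbar ∈ basicSubdiff θ (h xbar) ∧ jacAdjoint h xbar vbar = ybar) ∧
        (∀ v ∈ basicSubdiff θ (h xbar), jacAdjoint h xbar v = ybar → v = vbar) ∧
        ∀ u : EuclideanSpace ℝ (Fin n),
          secondOrderSubdiff φ xbar ybar u =
            (fun w => scalarizedHessian h vbar xbar u + jacAdjoint h xbar w) ''
              secondOrderSubdiff θ (h xbar) vbar (fderiv ℝ h xbar u)) ∧
    -- the second-order subdifferential of the outer function at the zero direction
    (∀ v ∈ basicSubdiff θ (h xbar),
      secondOrderSubdiff θ (h xbar) v 0 = (parallelSubspace θ (h xbar) : Set _)) ∧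
    -- the qualification condition as transversality of the subspaces `S(z)` for `z` near `h xbar`
    (SecondOrderQC θ h xbar ybar ↔
      ∀ᶠ z in 𝓝 (h xbar),
        (parallelSubspace θ z : Set _) ∩ {w | jacAdjoint h xbar w = 0} = {0}) ∧
    -- the qualification condition as a local full-rank condition
    (SecondOrderQC θ h xbar ybar ↔
      ∀ᶠ x in 𝓝 xbar,
        Module.finrank ℝ
            ((parallelSubspace θ (h xbar)).orthogonalProjectionOnto ∘L fderiv ℝ h x).range =
          Module.finrank ℝ (parallelSubspace θ (h xbar))) := by
  have hc := hamen.outer_convex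
  have hl := hamen.outer_lsc
  have hh := hamen.smooth
  have hφ := hamen.eventuallyEq
  obtain ⟨δ, hδ, hf⟩ := hpl.exists_radiallyAffine (h xbar)
  -- existence of a multiplier only needs the first-order qualification condition
  obtain ⟨v₀, hv₀, hv₀y⟩ := basicSubdiff_subset_jacAdjoint_image hl (hh.of_le (by norm_num)) hφ
    (fun w hw hw0 => by
      have : w ∈ singularSubdiff θ (h xbar) ∩ {v | jacAdjoint h xbar v = 0} := ⟨hw, hw0⟩
      rwa [hamen.firstOrderQC] at this) hy
  have hpar : ∀ z, parallelSubspace θ z = (affineSpan ℝ (convexSubdiff θ z)).direction := fun z => by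
    rw [parallelSubspace, hc.basicSubdiff_eq]
  have hzero : ∀ v ∈ basicSubdiff θ (h xbar),
      secondOrderSubdiff θ (h xbar) v 0 = (parallelSubspace θ (h xbar) : Set _) := by
    intro v hv
    rw [secondOrderSubdiff, hpar, hc.basicSubdiff_eq]
    rw [hc.basicSubdiff_eq] at hv
    exact coderivative_convexSubdiff_zero hf hδ hc hl hv
  have hqc : SecondOrderQC θ h xbar ybar ↔
      ∀ s ∈ parallelSubspace θ (h xbar), jacAdjoint h xbar s = 0 → s = 0 := by
    rw [← coe_inter_ker_eq_zero_iff]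
    refine ⟨fun H => ?_, fun H v hv _ => ?_⟩
    · rw [← hzero v₀ hv₀]
      exact H v₀ hv₀ hv₀y
    · rw [hzero v hv]
      exact H
  have hmem : ∀ v ∈ basicSubdiff θ (h xbar), v - v₀ ∈ parallelSubspace θ (h xbar) := fun v hv =>
    AffineSubspace.vsub_mem_direction (subset_affineSpan ℝ _ hv) (subset_affineSpan ℝ _ hv₀)
  have hsub : ∀ᶠ z in 𝓝 (h xbar), basicSubdiff θ z ⊆ basicSubdiff θ (h xbar) := by
    filter_upwards [eventually_norm_sub_lt (h xbar) (half_pos hδ)] with z hz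
    rw [hc.basicSubdiff_eq]
    exact hf.convexSubdiff_subset hz
  refine ⟨fun H => ⟨v₀, ⟨hv₀, hv₀y⟩, fun v hv hvy => ?_, fun u => ?_⟩, hzero, ?_, ?_⟩
  · refine sub_eq_zero.1 (hqc.1 H _ (hmem v hv) ?_)
    rw [map_sub, hvy, hv₀y, sub_self]
  · rw [← hv₀y]
    refine coderivative_comp (L := parallelSubspace θ (h xbar)) hh hv₀ (hqc.1 H) ?_ ?_ ?_ u
    · exact hsub.mono fun z hz v hv => hmem v (hz hv)
    · rw [nhds_prod_eq, hc.basicSubdiff_eq, hpar]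
      filter_upwards [(eventually_norm_sub_lt (h xbar) (half_pos hδ)).prod_mk
        (eventually_norm_sub_lt (h xbar) hδ)] with p hp hd
      exact hf.convexSubdiff_subset_of_sub_mem hδ hc hl hp.1 hp.2 hd
    · have H' := hqc.1 H
      rw [hpar] at H'
      rw [hc.basicSubdiff_eq] at hv₀ ⊢
      exact eventually_basicSubdiff_eq hf hδ hc hl hv₀ hh hφ H'
  · simp only [coe_inter_ker_eq_zero_iff]
    rw [hqc]
    refine ⟨fun H => hsub.mono fun z hz s hs => H s ?_, fun H => H.self_of_nhds⟩
    exact AffineSubspace.direction_le (affineSpan_mono ℝ hz) hs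
  · simp only [finrank_range_projection_comp_eq_iff]
    rw [hqc]
    refine ⟨fun H => ?_, fun H => H.self_of_nhds⟩
    obtain ⟨c, -, hcoer⟩ := exists_eventually_norm_le _ (jacAdjoint h xbar) H
    filter_upwards [(contDiffAt_jacAdjoint hh).continuousAt.eventually hcoer] with x hx s hs hs0
    have h1 := hx s hs
    rw [hs0, norm_zero, mul_zero] at h1
    exact norm_le_zero_iff.1 h1
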